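/- A range family is a set $\mathcal{R}$ of subsets of $\mathbb{R}^2$. A finite set $V\subset\mathbb{R}^2$ is in general position if its points have pairwise different $x$-coordinates, pairwise different $y$-coordinates, and pairwise different values of $x+y$. For such $V$ and a positive integer $m$, let $\mathcal{H}(V,\mathcal{R},m)$ be the hypergraph on the vertex set $V$ whose hyperedges are the sets $E=V\cap R$ with $R\in\mathcal{R}$ and $|E|=m$. A coloring $c\colon V\to\{1,\dots,k\}$ is polychromatic for it if every hyperedge contains at least one vertex of each of the $k$ colors. Let $m_{\mathcal{R}}(k)\in\{1,2,\dots\}\cup\{\infty\}$ be the smallest positive integer $m$ such that $\mathcal{H}(V,\mathcal{R},m)$ admits a polychromatic $k$-coloring for every finite $V\subset\mathbb{R}^2$ in general position ($\infty$ if there is no such $m$). With $a,a_1,a_2,b$ ranging over $\mathbb{R}$, consider the following range families: the south-west, south-east, north-east and north-west quadrants $\mathcal{R}_{\rm SW}=\{\{x\le a,\ y\le b\}\}$, $\mathcal{R}_{\rm SE}=\{\{x\ge a,\ y\le b\}\}$, $\mathcal{R}_{\rm NE}=\{\{x\ge a,\ y\ge b\}\}$, $\mathcal{R}_{\rm NW}=\{\{x\le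 a,\ y\ge b\}\}$; the horizontal, vertical and diagonal strips $\mathcal{R}_{\rm HS}=\{\{a\le y\le b\}\}$, $\mathcal{R}_{\rm VS}=\{\{a\le x\le b\}\}$, $\mathcal{R}_{\rm DS}=\{\{a\le x+y\le b\}\}$; and the bottomless rectangles $\mathcal{R}_{\rm BL}=\{\{a_1\le x\le a_2,\ y\le b\}\}$. Then for every integer $k\ge 1$: (1) for $\mathcal{R}=\mathcal{R}_{\rm BL}\cup\mathcal{R}_{\rm NW}\cup\mathcal{R}_{\rm NE}$, $m_{\mathcal{R}}(k)\le 5k-2$; (2) for $\mathcal{R}=\mathcal{R}_{\rm HS}\cup\mathcal{R}_{\rm VS}\cup\mathcal{R}_{\rm NW}\cup\mathcal{R}_{\rm NE}\cup\mathcal{R}_{\rm SW}\cup\mathcal{R}_{\rm SE}$, $m_{\mathcal{R}}(k)\le 10k-1$; (3) for $\mathcal{R}=\mathcal{R}_{\rm HS}\cup\mathcal{R}_{\rm VS}\cup\mathcal{R}_{\rm DS}\cup\mathcal{R}_{\rm NW}\cup\mathcal{R}_{\rm SE}$, $m_{\mathcal{R}}(k)\le\lceil 4k\ln k+k\ln 3\rceil+4k$.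 -/

import Mathlib

/-- A family of ranges: a set of subsets of the plane. -/
abbrev RangeFamily : Type := Set (Set (ℝ × ℝ))

namespace RangeFamily

/-- South-west quadrants. -/
def SW : RangeFamily := {R | ∃ a b : ℝ, R = {p | p.1 ≤ a ∧ p.2 ≤ b}}

/-- South-east quadrants. -/
def SE : RangeFamily := {R | ∃ a b : ℝ, R = {p | a ≤ p.1 ∧ p.2 ≤ b}}

/-- North-east quadrants. -/
def NE : RangeFamily := {R | ∃ a b : ℝ, R = {p | a ≤ p.1 ∧ b ≤ p.2}}

/-- North-west quadrants. -/
def NW : RangeFamily := {R | ∃ a b : ℝ, R = {p | p.1 ≤ a ∧ b ≤ p.2}}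

/-- Horizontal strips. -/
def HS : RangeFamily := {R | ∃ a b : ℝ, R = {p | a ≤ p.2 ∧ p.2 ≤ b}}

/-- Vertical strips. -/
def VS : RangeFamily := {R | ∃ a b : ℝ, R = {p | a ≤ p.1 ∧ p.1 ≤ b}}

/-- Diagonal strips of slope `-1`. -/
def DS : RangeFamily := {R | ∃ a b : ℝ, R = {p | a ≤ p.1 + p.2 ∧ p.1 + p.2 ≤ b}}

/-- Bottomless rectangles. -/
def BL : RangeFamily := {R | ∃ a₁ a₂ b : ℝ, R = {p | a₁ ≤ p.1 ∧ p.1 ≤ a₂ ∧ p.2 ≤ b}}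

end RangeFamily

/-- General position: pairwise different `x`-coordinates, pairwise different `y`-coordinates, and
pairwise different sums of `x`- and `y`-coordinates. -/
def InGeneralPosition (V : Finset (ℝ × ℝ)) : Prop :=
  Set.InjOn (fun p : ℝ × ℝ => p.1) (V : Set (ℝ × ℝ)) ∧
  Set.InjOn (fun p : ℝ × ℝ => p.2) (V : Set (ℝ × ℝ)) ∧
  Set.InjOn (fun p : ℝ × ℝ => p.1 + p.2) (V : Set (ℝ × ℝ))

/-- The range capturing hypergraph `H(V, ℛ)`: its vertex set is `V`, and its hyperedges are the
sets `V ∩ R` with `R ∈ ℛ`. -/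
def capturingHypergraph (V : Finset (ℝ × ℝ)) (ℛ : RangeFamily) : Hypergraph (ℝ × ℝ) where
  vertexSet := (V : Set (ℝ × ℝ))
  edgeSet := {E | ∃ R ∈ ℛ, E = (V : Set (ℝ × ℝ)) ∩ R}
  subset_vertexSet_of_mem_edgeSet' := by
    rintro E ⟨R, -, rfl⟩
    exact Set.inter_subset_left

/-- The `m`-uniform subhypergraph `H(V, ℛ, m)`: all hyperedges of `H(V, ℛ)` with exactly `m`
points. (They are finite, being subsets of `V`.) -/
def uniformCapturingHypergraph (V : Finset (ℝ × ℝ)) (ℛ : RangeFamily) (m : ℕ) :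
    Hypergraph (ℝ × ℝ) where
  vertexSet := (V : Set (ℝ × ℝ))
  edgeSet := {E | E ∈ (capturingHypergraph V ℛ).edgeSet ∧ E.ncard = m}
  subset_vertexSet_of_mem_edgeSet' := fun _ hE =>
    (capturingHypergraph V ℛ).subset_vertexSet_of_mem_edgeSet' hE.1

/-- A `k`-coloring of the vertices of a hypergraph is polychromatic if each hyperedge contains at
least one vertex of each of the `k` colors. -/
def Hypergraph.IsPolychromatic {α : Type*} (H : Hypergraph α) {k : ℕ}
    (c : H.vertexSet → Fin k) : Prop :=
  ∀ E ∈ H.edgeSet, ∀ i : Fin k, ∃ v : H.vertexSet, (v : α) ∈ E ∧ c v = i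

/-- `H(V, ℛ, m)` admits a polychromatic `k`-coloring for every finite point set `V` in general
position. -/
def AlwaysPolychromatic (ℛ : RangeFamily) (k m : ℕ) : Prop :=
  ∀ V : Finset (ℝ × ℝ), InGeneralPosition V →
    ∃ c : (uniformCapturingHypergraph V ℛ m).vertexSet → Fin k,
      (uniformCapturingHypergraph V ℛ m).IsPolychromatic c

/-- The number `m(k)` of a range family: the smallest positive integer `m` such that `H(V, ℛ, m)`
admits a polychromatic `k`-coloring for every finite `V` in general position (`⊤` if there is no
such `m`). -/
noncomputable def polychromaticNumber (ℛ : RangeFamily) (k : ℕ) : ℕ∞ :=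
  sInf {n : ℕ∞ | ∃ m : ℕ, 0 < m ∧ AlwaysPolychromatic ℛ k m ∧ n = (m : ℕ∞)}

open Finset

/-- The colouring `c` shows every colour on every range of `ℛ` with at least `m` points of `V`. -/
def ShowsAllColors (V : Finset (ℝ × ℝ)) (ℛ : RangeFamily) (m : ℕ) {k : ℕ}
    (c : ℝ × ℝ → Fin k) : Prop :=
  ∀ R ∈ ℛ, ∀ W : Finset (ℝ × ℝ), (∀ p, p ∈ W ↔ p ∈ V ∧ p ∈ R) → m ≤ #W →
    ∀ i, ∃ v ∈ W, c v = i

theorem InGeneralPosition.subset {V W : Finset (ℝ × ℝ)} (hV : InGeneralPosition V)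
    (h : W ⊆ V) : InGeneralPosition W :=
  ⟨hV.1.mono (by exact_mod_cast h), hV.2.1.mono (by exact_mod_cast h),
    hV.2.2.mono (by exact_mod_cast h)⟩

theorem polychromaticNumber_le {ℛ : RangeFamily} {k m n : ℕ} (hm : 0 < m) (hmn : m ≤ n)
    (h : ∀ V, InGeneralPosition V → ∃ c : ℝ × ℝ → Fin k, ShowsAllColors V ℛ m c) :
    polychromaticNumber ℛ k ≤ (n : ℕ∞) := by
  classical
  refine le_trans (sInf_le ⟨m, hm, ?_, rfl⟩) (by exact_mod_cast hmn)
  intro V hV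
  obtain ⟨c, hc⟩ := h V hV
  refine ⟨fun v => c v.1, ?_⟩
  rintro E ⟨⟨R, hR, rfl⟩, hE⟩ i
  have hW : ((V.filter (· ∈ R) : Finset (ℝ × ℝ)) : Set (ℝ × ℝ)) = (V : Set (ℝ × ℝ)) ∩ R := by
    ext p; simp
  rw [← hW, Set.ncard_coe_finset] at hE
  obtain ⟨v, hv, hi⟩ := hc R hR (V.filter (· ∈ R)) (by simp) hE.ge i
  rw [mem_filter] at hv
  exact ⟨⟨v, by exact hv.1⟩, ⟨by exact_mod_cast hv.1, hv.2⟩, hi⟩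

/-- Every range with at least `n ≥ 1` points contains a range with exactly `n` of them. -/
def IsShrinkable (ℛ : RangeFamily) : Prop :=
  ∀ V, InGeneralPosition V → ∀ R ∈ ℛ, ∀ n, 1 ≤ n → ∀ W : Finset (ℝ × ℝ),
    (∀ p, p ∈ W ↔ p ∈ V ∧ p ∈ R) → n ≤ #W →
      ∃ R' ∈ ℛ, ∃ W' ⊆ W, (∀ p, p ∈ W' ↔ p ∈ V ∧ p ∈ R') ∧ #W' = n

theorem exists_threshold {α : Type*} (f : α → ℝ) (W : Finset α) (hf : Set.InjOn f W) (n : ℕ)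
    (hn : 1 ≤ n) (h : n ≤ #W) : ∃ t : ℝ, #(W.filter (fun p => f p ≤ t)) = n := by
  classical
  induction W using Finset.induction_on_max_value f with
  | empty => simp at h; omega
  | insert a s ha hmax ih =>
    have hlt : ∀ p ∈ s, f p < f a := fun p hp => lt_of_le_of_ne (hmax p hp) fun e =>
      ha (hf (by simp [hp]) (by simp) e ▸ hp)
    by_cases hs : n ≤ #s
    · obtain ⟨t, ht⟩ := ih (hf.mono (by simp)) hs
      have hne : (s.filter (fun p => f p ≤ t)).Nonempty := by
        rw [← card_pos]; omega
      refine ⟨(s.filter (fun p => f p ≤ t)).sup' hne f, ?_⟩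
      rw [← ht]
      congr 1
      obtain ⟨b, hb, hbe⟩ := exists_mem_eq_sup' hne f
      rw [mem_filter] at hb
      ext p
      simp only [mem_filter, mem_insert, hbe]
      constructor
      · rintro ⟨rfl | hp, h2⟩
        · exact absurd h2 (not_le.2 (hlt _ hb.1))
        · exact ⟨hp, h2.trans hb.2⟩
      · rintro ⟨hp, h2⟩
        exact ⟨.inr hp, hbe ▸ le_sup' f (mem_filter.2 ⟨hp, h2⟩)⟩
    · refine ⟨f a, ?_⟩
      rw [filter_true_of_mem]
      · rw [card_insert_of_notMem ha] at h ⊢; omega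
      · intro p hp
        rcases mem_insert.1 hp with rfl | hp
        · exact le_rfl
        · exact hmax p hp

theorem isShrinkable_of_inter {ℛ : RangeFamily} (f : ℝ × ℝ → ℝ)
    (hf : ∀ V, InGeneralPosition V → Set.InjOn f V)
    (h : ∀ R ∈ ℛ, ∀ t, R ∩ {p | f p ≤ t} ∈ ℛ) : IsShrinkable ℛ := by
  classical
  intro V hV R hR n hn W hW hnW
  obtain ⟨t, ht⟩ := exists_threshold f W
    ((hf V hV).mono fun p hp => by exact_mod_cast ((hW p).1 hp).1) n hn hnW
  refine ⟨_, h R hR t, _, filter_subset _ _, fun p => ?_, ht⟩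
  simp [hW, and_assoc]

theorem IsShrinkable.union {ℛ 𝒮 : RangeFamily} (h : IsShrinkable ℛ) (h' : IsShrinkable 𝒮) :
    IsShrinkable (ℛ ∪ 𝒮) := by
  rintro V hV R (hR | hR) n hn W hW hnW
  · obtain ⟨R', h1, h2⟩ := h V hV R hR n hn W hW hnW
    exact ⟨R', .inl h1, h2⟩
  · obtain ⟨R', h1, h2⟩ := h' V hV R hR n hn W hW hnW
    exact ⟨R', .inr h1, h2⟩

namespace RangeFamily

theorem isShrinkable_NW : IsShrinkable NW := by
  refine isShrinkable_of_inter (fun p => p.1) (fun V hV => hV.1) ?_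
  rintro R ⟨a, b, rfl⟩ t
  refine ⟨min a t, b, ?_⟩
  ext p
  simp only [Set.mem_inter_iff, Set.mem_ofPred_eq, le_min_iff]
  tauto

theorem isShrinkable_SW : IsShrinkable SW := by
  refine isShrinkable_of_inter (fun p => p.1) (fun V hV => hV.1) ?_
  rintro R ⟨a, b, rfl⟩ t
  refine ⟨min a t, b, ?_⟩
  ext p
  simp only [Set.mem_inter_iff, Set.mem_ofPred_eq, le_min_iff]
  tauto

theorem isShrinkable_SE : IsShrinkable SE := by
  refine isShrinkable_of_inter (fun p => p.2) (fun V hV => hV.2.1) ?_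
  rintro R ⟨a, b, rfl⟩ t
  refine ⟨a, min b t, ?_⟩
  ext p
  simp only [Set.mem_inter_iff, Set.mem_ofPred_eq, le_min_iff]
  tauto

theorem isShrinkable_NE : IsShrinkable NE := by
  refine isShrinkable_of_inter (fun p => -p.1)
    (fun V hV p hp q hq h => hV.1 hp hq (neg_injective h)) ?_
  rintro R ⟨a, b, rfl⟩ t
  refine ⟨max a (-t), b, ?_⟩
  ext p
  simp only [Set.mem_inter_iff, Set.mem_ofPred_eq, max_le_iff, neg_le (a := t)]
  tauto

theorem isShrinkable_HS : IsShrinkable HS := by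
  refine isShrinkable_of_inter (fun p => p.2) (fun V hV => hV.2.1) ?_
  rintro R ⟨a, b, rfl⟩ t
  refine ⟨a, min b t, ?_⟩
  ext p
  simp only [Set.mem_inter_iff, Set.mem_ofPred_eq, le_min_iff]
  tauto

theorem isShrinkable_VS : IsShrinkable VS := by
  refine isShrinkable_of_inter (fun p => p.1) (fun V hV => hV.1) ?_
  rintro R ⟨a, b, rfl⟩ t
  refine ⟨a, min b t, ?_⟩
  ext p
  simp only [Set.mem_inter_iff, Set.mem_ofPred_eq, le_min_iff]
  tauto

theorem isShrinkable_DS : IsShrinkable DS := by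
  refine isShrinkable_of_inter (fun p => p.1 + p.2) (fun V hV => hV.2.2) ?_
  rintro R ⟨a, b, rfl⟩ t
  refine ⟨a, min b t, ?_⟩
  ext p
  simp only [Set.mem_inter_iff, Set.mem_ofPred_eq, le_min_iff]
  tauto

theorem isShrinkable_BL : IsShrinkable BL := by
  refine isShrinkable_of_inter (fun p => p.2) (fun V hV => hV.2.1) ?_
  rintro R ⟨a₁, a₂, b, rfl⟩ t
  refine ⟨a₁, a₂, min b t, ?_⟩
  ext p
  simp only [Set.mem_inter_iff, Set.mem_ofPred_eq, le_min_iff]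
  tauto

end RangeFamily

/-- Every point set has a set of vertices that meets all ranges of `ℱ` with at least `n` points,
and contains at most `t` points of each range of `ℱ ∪ 𝒢` with exactly `n` points. -/
def HasShallowHittingSets (ℱ 𝒢 : RangeFamily) (t : ℕ) : Prop :=
  ∀ V, InGeneralPosition V → ∀ n, 1 ≤ n → ∃ X ⊆ V, ∀ W : Finset (ℝ × ℝ),
    (∀ R ∈ ℱ, (∀ p, p ∈ W ↔ p ∈ V ∧ p ∈ R) → n ≤ #W → (X ∩ W).Nonempty) ∧
    (∀ R ∈ ℱ ∪ 𝒢, (∀ p, p ∈ W ↔ p ∈ V ∧ p ∈ R) → #W = n → #(X ∩ W) ≤ t)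

theorem exists_showsAllColors_of_hasShallowHittingSets {ℱ 𝒢 : RangeFamily} {t k M : ℕ}
    (hM : 1 ≤ M) (hF : IsShrinkable ℱ) (hG : IsShrinkable 𝒢)
    (hit : HasShallowHittingSets ℱ 𝒢 t)
    (hc : ∀ V, InGeneralPosition V → ∃ c : ℝ × ℝ → Fin k, ShowsAllColors V 𝒢 M c)
    (V : Finset (ℝ × ℝ)) (hV : InGeneralPosition V) :
    ∃ c : ℝ × ℝ → Fin k, ShowsAllColors V (ℱ ∪ 𝒢) (M + t * k) c := by
  classical
  have key : ∀ j ≤ k, ∀ V, InGeneralPosition V → ∃ c : ℝ × ℝ → Fin k,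
      ShowsAllColors V 𝒢 (M + t * j) c ∧
      ∀ R ∈ ℱ, ∀ W : Finset (ℝ × ℝ), (∀ p, p ∈ W ↔ p ∈ V ∧ p ∈ R) → M + t * j ≤ #W →
        ∀ i : Fin k, (i : ℕ) < j → ∃ v ∈ W, c v = i := by
    intro j
    induction j with
    | zero =>
      intro _ V hV
      obtain ⟨c, hc⟩ := hc V hV
      exact ⟨c, by simpa using hc, fun R _ W _ _ i hi => absurd hi (by omega)⟩
    | succ j ih =>
      intro hj V hV
      obtain ⟨X, hXV, hX⟩ := hit V hV (M + t * (j + 1)) (by omega)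
      obtain ⟨c, hc1, hc2⟩ := ih (by omega) (V \ X) (hV.subset sdiff_subset)
      have main : ∀ R ∈ ℱ ∪ 𝒢, ∀ W : Finset (ℝ × ℝ), (∀ p, p ∈ W ↔ p ∈ V ∧ p ∈ R) →
          #W = M + t * (j + 1) → M + t * j ≤ #(W \ X) := by
        intro R hR W hW hcard
        have h1 := (hX W).2 R hR hW hcard
        have h2 := card_sdiff_add_card_inter W X
        rw [inter_comm] at h2
        rw [mul_add] at hcard
        omega
      refine ⟨fun p => if p ∈ X then ⟨j, by omega⟩ else c p, ?_, ?_⟩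
      · intro R hR W hW hcard i
        obtain ⟨R', hR', W', hW'W, hW', hcard'⟩ := hG V hV R hR _ (by omega) W hW hcard
        obtain ⟨v, hv, hvi⟩ := hc1 R' hR' (W' \ X) (fun p => by simp [hW']; tauto)
          (main R' (.inr hR') W' hW' hcard') i
        rw [mem_sdiff] at hv
        exact ⟨v, hW'W hv.1, by simpa [hv.2] using hvi⟩
      · intro R hR W hW hcard i hi
        rcases Nat.lt_succ_iff_lt_or_eq.1 hi with hi | hi
        · obtain ⟨R', hR', W', hW'W, hW', hcard'⟩ := hF V hV R hR _ (by omega) W hW hcard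
          obtain ⟨v, hv, hvi⟩ := hc2 R' hR' (W' \ X) (fun p => by simp [hW']; tauto)
            (main R' (.inl hR') W' hW' hcard') i hi
          rw [mem_sdiff] at hv
          exact ⟨v, hW'W hv.1, by simpa [hv.2] using hvi⟩
        · obtain ⟨v, hv⟩ := (hX W).1 R hR hW hcard
          rw [mem_inter] at hv
          exact ⟨v, hv.2, by simp [hv.1, ← hi]⟩
  obtain ⟨c, h1, h2⟩ := key k le_rfl V hV
  refine ⟨c, ?_⟩
  rintro R (hR | hR) W hW hcard i
  · exact h2 R hR W hW hcard i i.2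
  · exact h1 R hR W hW hcard i

section Quadrants

variable {α : Type*} [DecidableEq α]

theorem exists_lt_lt_of_two_lt_card {f : α → ℝ} {Y : Finset α} (hf : Set.InjOn f Y)
    (h : 2 < #Y) : ∃ p ∈ Y, ∃ q ∈ Y, ∃ r ∈ Y, f p < f q ∧ f q < f r := by
  have hne : Y.Nonempty := card_pos.1 (by omega)
  obtain ⟨p, hp, hmin⟩ := exists_min_image Y f hne
  obtain ⟨r, hr, hmax⟩ := exists_max_image Y f hne
  have : ((Y.erase p).erase r).Nonempty := by
    rw [← card_pos]
    have h1 := pred_card_le_card_erase (a := p) (s := Y)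
    have h2 := pred_card_le_card_erase (a := r) (s := Y.erase p)
    omega
  obtain ⟨q, hq⟩ := this
  simp only [mem_erase] at hq
  exact ⟨p, hp, q, hq.2.2, r, hr,
    lt_of_le_of_ne (hmin q hq.2.2) fun e => hq.2.1 (hf hp hq.2.2 e).symm,
    lt_of_le_of_ne (hmax q hq.2.2) fun e => hq.1 (hf hq.2.2 hr e)⟩

/-- The box spanned by two points of the set in decreasing position is contained in the set. -/
def IsBoxConvex (u v : α → ℝ) (R : Set α) : Prop :=
  ∀ p ∈ R, ∀ q ∈ R, ∀ w, u p ≤ u w → u w ≤ u q → v q ≤ v w → v w ≤ v p → w ∈ R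

theorem exists_quadrant_hitting (u v : α → ℝ) (V : Finset α) (hu : Set.InjOn u V)
    (n : ℕ) (hn : 1 ≤ n) :
    ∃ X ⊆ V, (∀ a b, n ≤ #(V.filter fun p => u p ≤ a ∧ v p ≤ b) →
        ∃ p ∈ X, u p ≤ a ∧ v p ≤ b) ∧
      ∀ R : Set α, IsBoxConvex u v R → ∀ W : Finset α, (∀ p, p ∈ W ↔ p ∈ V ∧ p ∈ R) →
        #W = n → #(X ∩ W) ≤ 2 := by
  classical
  set S : Finset α := V.filter fun p => ∀ q ∈ V, u q ≤ u p → v q ≤ v p → q = p with hS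
  set hits : Finset α → Prop := fun X =>
    ∀ a b, n ≤ #(V.filter fun p => u p ≤ a ∧ v p ≤ b) → ∃ p ∈ X, u p ≤ a ∧ v p ≤ b with hhits
  have hSh : hits S := by
    intro a b hab
    obtain ⟨p, hp, hmin⟩ := exists_min_image (V.filter fun p => u p ≤ a ∧ v p ≤ b)
      (fun p => u p + v p) (card_pos.1 (by omega))
    rw [mem_filter] at hp
    refine ⟨p, mem_filter.2 ⟨hp.1, fun q hq h1 h2 => ?_⟩, hp.2⟩
    have := hmin q (mem_filter.2 ⟨hq, h1.trans hp.2.1, h2.trans hp.2.2⟩)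
    exact hu hq hp.1 (by linarith)
  obtain ⟨X, hX, hmin⟩ := exists_min_image (S.powerset.filter hits) card
    ⟨S, by simp [hSh]⟩
  rw [mem_filter, mem_powerset] at hX
  obtain ⟨hXS, hXh⟩ := hX
  have hXV : X ⊆ V := hXS.trans (filter_subset _ _)
  refine ⟨X, hXV, hXh, fun R hR W hW hcard => ?_⟩
  by_contra! h3
  obtain ⟨p₁, h1, p₂, h2, p₃, h3, h12, h23⟩ := exists_lt_lt_of_two_lt_card (f := u)
    (hu.mono fun x hx => by exact_mod_cast hXV (mem_inter.1 hx).1) h3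
  rw [mem_inter] at h1 h2 h3
  have hS1 := (mem_filter.1 (hXS h1.1)).2
  have hS3 := (mem_filter.1 (hXS h3.1)).2
  have hnot : ¬ hits (X.erase p₂) := by
    intro hh
    have := hmin (X.erase p₂)
      (by rw [mem_filter, mem_powerset]; exact ⟨(erase_subset _ _).trans hXS, hh⟩)
    have := card_erase_lt_of_mem h2.1
    omega
  simp only [hhits, not_forall, not_exists, not_and] at hnot
  obtain ⟨a, b, hab, hnot⟩ := hnot
  obtain ⟨p, hpX, hpa, hpb⟩ := hXh a b hab
  obtain rfl : p = p₂ := by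
    by_contra hne
    exact hnot p (mem_erase.2 ⟨hne, hpX⟩) hpa hpb
  have e1 := hnot p₁ (mem_erase.2 ⟨fun e => h12.ne (e ▸ rfl), h1.1⟩) (h12.le.trans hpa)
  have e3 : ¬ u p₃ ≤ a := by
    intro ha
    refine hnot p₃ (mem_erase.2 ⟨fun e => h23.ne (e ▸ rfl), h3.1⟩) ha ?_
    by_contra! hb
    have := hS3 p (hXV hpX) h23.le (hpb.trans hb.le)
    exact h23.ne (this ▸ rfl)
  have hsub : insert p₁ (V.filter fun q => u q ≤ a ∧ v q ≤ b) ⊆ W := by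
    intro q hq
    rcases mem_insert.1 hq with rfl | hq
    · exact h1.2
    rw [mem_filter] at hq
    obtain ⟨hqV, hqa, hqb⟩ := hq
    push Not at e1 e3
    refine (hW q).2 ⟨hqV, hR p₁ ((hW _).1 h1.2).2 p₃ ((hW _).1 h3.2).2 q ?_ ?_ ?_ ?_⟩
    · by_contra! hlt
      have := hS1 q hqV hlt.le (by linarith)
      exact hlt.ne (this ▸ rfl)
    · linarith
    · by_contra! hlt
      have := hS3 q hqV (by linarith) hlt.le
      exact hlt.ne (this ▸ rfl)
    · linarith
  have := card_le_card hsub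
  rw [card_insert_of_notMem (fun h => e1 (mem_filter.1 h).2.2)] at this
  omega

/-- Sweeping the points by decreasing `y`, whenever the first `m` points (with respect to `x`)
contain no chosen point, choose the first point. -/
theorem exists_leftmost_sweep (x y : α → ℝ) (m : ℕ) (hm : 1 ≤ m) (V : Finset α)
    (hx : Set.InjOn x V) (hy : Set.InjOn y V) :
    ∃ L ⊆ V,
      (∀ a b, m ≤ #(V.filter fun p => x p ≤ a ∧ b ≤ y p) → ∃ l ∈ L, x l ≤ a ∧ b ≤ y l) ∧
      (∀ l ∈ L, ∀ l' ∈ L, x l < x l' →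
        m < #(V.filter fun q => x l ≤ x q ∧ x q ≤ x l' ∧ y q ≤ y l')) ∧
      (∀ l ∈ L, ∀ l' ∈ L, x l < x l' → ∀ s ∈ V, x s < x l →
        m ≤ #(V.filter fun q => x q < x l' ∧ y s < y q)) ∧
      (∀ l ∈ L, ∀ s ∈ V, x s < x l → m ≤ #(V.filter fun q => y s < y q)) ∧
      (∀ l ∈ L, ∀ s ∈ V, x s < x l → y s < y l) ∧
      (L.Nonempty → m ≤ #V) := by
  induction V using Finset.induction_on_max_value (fun p => -y p) with
  | empty => exact ⟨∅, by simp; omega⟩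
  | insert p V hp hmax ih =>
    have hlow : ∀ q ∈ V, y p < y q := fun q hq =>
      lt_of_le_of_ne (by simpa using hmax q hq) fun e =>
        hp (hy (by simp) (by simp [hq]) e ▸ hq)
    obtain ⟨L, hLV, hhit, hb, hf, hh, hi, hj⟩ := ih (hx.mono (by simp)) (hy.mono (by simp))
    have hsub : V ⊆ insert p V := subset_insert _ _
    have mono : ∀ P : α → Prop, [DecidablePred P] → #(V.filter P) ≤ #((insert p V).filter P) :=
      fun P _ => card_le_card (filter_subset_filter _ hsub)
    have hb' : ∀ l ∈ L, ∀ l' ∈ L, x l < x l' →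
        m < #((insert p V).filter fun q => x l ≤ x q ∧ x q ≤ x l' ∧ y q ≤ y l') :=
      fun l hl l' hl' h => (hb l hl l' hl' h).trans_le (mono _)
    have hh' : ∀ l ∈ L, ∀ s ∈ insert p V, x s < x l →
        m ≤ #((insert p V).filter fun q => y s < y q) := by
      intro l hl s hs hlt
      rcases mem_insert.1 hs with rfl | hs
      · refine (hj ⟨l, hl⟩).trans (card_le_card fun q hq => ?_)
        exact mem_filter.2 ⟨hsub hq, hlow q hq⟩
      · exact (hh l hl s hs hlt).trans (mono _)
    have hf' : ∀ l ∈ L, ∀ l' ∈ L, x l < x l' → ∀ s ∈ insert p V, x s < x l →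
        m ≤ #((insert p V).filter fun q => x q < x l' ∧ y s < y q) := by
      intro l hl l' hl' hll s hs hlt
      rcases mem_insert.1 hs with rfl | hs
      · have h1 := hb l hl l' hl' hll
        have h2 : (V.filter fun q => x l ≤ x q ∧ x q ≤ x l' ∧ y q ≤ y l') ⊆
            insert l' ((insert s V).filter fun q => x q < x l' ∧ y s < y q) := by
          intro q hq
          rw [mem_filter] at hq
          by_cases hql : q = l'
          · simp [hql]
          · refine mem_insert_of_mem (mem_filter.2 ⟨hsub hq.1, ?_, hlow q hq.1⟩)
            exact lt_of_le_of_ne hq.2.2.1 fun e =>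
              hql (hx (hsub hq.1) (hsub (hLV hl')) e)
        have h3 := (card_le_card h2).trans (card_insert_le _ _)
        omega
      · exact (hf l hl l' hl' hll s hs hlt).trans (mono _)
    have hi' : ∀ l ∈ L, ∀ s ∈ insert p V, x s < x l → y s < y l := by
      intro l hl s hs hlt
      rcases mem_insert.1 hs with rfl | hs
      · exact hlow l (hLV hl)
      · exact hi l hl s hs hlt
    have hhit' : ∀ a b, y p < b → m ≤ #((insert p V).filter fun p => x p ≤ a ∧ b ≤ y p) →
        ∃ l ∈ L, x l ≤ a ∧ b ≤ y l := by
      intro a b hpb hab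
      rw [filter_insert, if_neg (fun h => absurd h.2 (not_le.2 hpb))] at hab
      exact hhit a b hab
    by_cases hC : (∃ l ∈ L, #((insert p V).filter fun q => x q < x l) < m) ∨ #(insert p V) < m
    · refine ⟨L, hLV.trans hsub, fun a b hab => ?_, hb', hf', hh', hi',
        fun h => (hj h).trans (card_le_card hsub)⟩
      rcases lt_or_ge (y p) b with hpb | hpb
      · exact hhit' a b hpb hab
      rcases hC with ⟨l, hl, hlm⟩ | hC
      · refine ⟨l, hl, ?_, hpb.trans (hlow l (hLV hl)).le⟩
        by_contra! hla
        have : #((insert p V).filter fun p => x p ≤ a ∧ b ≤ y p) ≤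
            #((insert p V).filter fun q => x q < x l) :=
          card_le_card (monotone_filter_right _ fun q _ h => h.1.trans_lt hla)
        omega
      · have := card_le_card (filter_subset (fun p => x p ≤ a ∧ b ≤ y p) (insert p V))
        omega
    · push Not at hC
      obtain ⟨hC1, hC2⟩ := hC
      obtain ⟨l₀, hl₀, hmin⟩ := exists_min_image (insert p V) x (insert_nonempty _ _)
      refine ⟨insert l₀ L, insert_subset hl₀ (hLV.trans hsub), fun a b hab => ?_, ?_, ?_, ?_, ?_,
        fun _ => hC2⟩
      · rcases lt_or_ge (y p) b with hpb | hpb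
        · obtain ⟨l, hl, h⟩ := hhit' a b hpb hab
          exact ⟨l, mem_insert_of_mem hl, h⟩
        · refine ⟨l₀, mem_insert_self _ _, ?_, ?_⟩
          · obtain ⟨q, hq⟩ : ((insert p V).filter fun p => x p ≤ a ∧ b ≤ y p).Nonempty :=
              card_pos.1 (by omega)
            rw [mem_filter] at hq
            exact (hmin q hq.1).trans hq.2.1
          · rcases mem_insert.1 hl₀ with h | h
            · rwa [h]
            · exact hpb.trans (hlow _ h).le
      · intro l hl l' hl' hlt
        rcases mem_insert.1 hl' with rfl | hlL'
        · rcases mem_insert.1 hl with rfl | hlL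
          · exact absurd hlt (lt_irrefl _)
          · exact absurd hlt (not_lt.2 (hmin _ (hsub (hLV hlL))))
        rcases mem_insert.1 hl with rfl | hlL
        · have h1 := hC1 l' hlL'
          have h2 : insert l' ((insert p V).filter fun q => x q < x l') ⊆
              (insert p V).filter fun q => x l ≤ x q ∧ x q ≤ x l' ∧ y q ≤ y l' := by
            intro q hq
            rcases mem_insert.1 hq with rfl | hq
            · exact mem_filter.2 ⟨hsub (hLV hlL'), hlt.le, le_rfl, le_rfl⟩
            · rw [mem_filter] at hq
              exact mem_filter.2 ⟨hq.1, hmin q hq.1, hq.2.le, (hi' l' hlL' q hq.1 hq.2).le⟩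
          have h3 := card_le_card h2
          rw [card_insert_of_notMem (by simp)] at h3
          omega
        · exact hb' l hlL l' hlL' hlt
      · intro l hl l' hl' hlt s hs hsl
        rcases mem_insert.1 hl with rfl | hlL
        · exact absurd hsl (not_lt.2 (hmin _ hs))
        rcases mem_insert.1 hl' with rfl | hlL'
        · exact absurd hlt (not_lt.2 (hmin _ (hsub (hLV hlL))))
        exact hf' l hlL l' hlL' hlt s hs hsl
      · intro l hl s hs hsl
        rcases mem_insert.1 hl with rfl | hl
        · exact absurd hsl (not_lt.2 (hmin _ hs))
        exact hh' l hl s hs hsl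
      · intro l hl s hs hsl
        rcases mem_insert.1 hl with rfl | hl
        · exact absurd hsl (not_lt.2 (hmin _ hs))
        exact hi' l hl s hs hsl

theorem card_inter_quadrant_le_two (x y : α → ℝ) (n : ℕ) (V L R W : Finset α)
    (hx : Set.InjOn x V) (hL : L ⊆ V) (hR : R ⊆ V)
    (hLf : ∀ l ∈ L, ∀ l' ∈ L, x l < x l' → ∀ s ∈ V, x s < x l →
        n ≤ #(V.filter fun q => x q < x l' ∧ y s < y q))
    (hLh : ∀ l ∈ L, ∀ s ∈ V, x s < x l → n ≤ #(V.filter fun q => y s < y q))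
    (hRh : ∀ r ∈ R, ∀ s ∈ V, x r < x s → n ≤ #(V.filter fun q => y s < y q))
    (a b : ℝ) (hW : ∀ p, p ∈ W ↔ p ∈ V ∧ x p ≤ a ∧ b ≤ y p) (hcard : #W = n) :
    #((L ∪ R) ∩ W) ≤ 2 := by
  rw [union_inter_distrib_right]
  have tooMany : ∀ T : Finset α, ∀ l ∈ W, l ∉ T → T ⊆ W → ¬ n ≤ #T := by
    intro T l hl hlT hT hn
    have := card_le_card (insert_subset hl hT)
    rw [card_insert_of_notMem hlT] at this
    omega
  rcases (R ∩ W).eq_empty_or_nonempty with hRW | ⟨r, hr⟩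
  · rw [hRW, union_empty]
    by_contra! h
    obtain ⟨l₁, h1, l₂, h2, l₃, h3, h12, h23⟩ := exists_lt_lt_of_two_lt_card (f := x)
      (hx.mono fun q hq => by exact_mod_cast hL (mem_inter.1 hq).1) h
    rw [mem_inter] at h1 h2 h3
    have := hLf l₂ h2.1 l₃ h3.1 h23 l₁ (hL h1.1) h12
    refine tooMany _ l₁ h1.2 (by simp) (fun q hq => ?_) this
    rw [mem_filter] at hq
    exact (hW q).2 ⟨hq.1, hq.2.1.le.trans ((hW _).1 h3.2).2.1,
      ((hW _).1 h1.2).2.2.trans hq.2.2.le⟩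
  · rw [mem_inter] at hr
    have key : ∀ l ∈ W, ¬ n ≤ #(V.filter fun q => y l < y q) := by
      intro l hl hn
      by_cases hall : (V.filter fun q => y l < y q) ⊆ W
      · exact tooMany _ l hl (by simp) hall hn
      · obtain ⟨q₀, hq₀, hmax⟩ := exists_max_image
          ((V.filter fun q => y l < y q) \ W) y (sdiff_nonempty.2 hall)
        rw [mem_sdiff, mem_filter] at hq₀
        obtain ⟨⟨hqV, hlq⟩, hqW⟩ := hq₀
        have hbl := ((hW _).1 hl).2.2
        have hqa : a < x q₀ := by
          by_contra! h
          exact hqW ((hW _).2 ⟨hqV, h, hbl.trans hlq.le⟩)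
        refine tooMany _ l hl (fun h => ?_) (fun q hq => ?_)
          (hRh r hr.1 q₀ hqV ((((hW _).1 hr.2).2.1).trans_lt hqa))
        · exact absurd (mem_filter.1 h).2 (not_lt.2 hlq.le)
        · rw [mem_filter] at hq
          by_contra hqW'
          exact absurd hq.2 (not_lt.2 (hmax q
            (mem_sdiff.2 ⟨mem_filter.2 ⟨hq.1, hlq.trans hq.2⟩, hqW'⟩)))
    have hL1 : #(L ∩ W) ≤ 1 := by
      rw [card_le_one]
      have aux : ∀ l ∈ L ∩ W, ∀ l' ∈ L ∩ W, ¬ x l < x l' := fun l hl l' hl' hlt =>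
        key l (mem_inter.1 hl).2
          (hLh l' (mem_inter.1 hl').1 l (hL (mem_inter.1 hl).1) hlt)
      intro l hl l' hl'
      exact hx (hL (mem_inter.1 hl).1) (hL (mem_inter.1 hl').1)
        (le_antisymm (not_lt.1 (aux _ hl' _ hl)) (not_lt.1 (aux _ hl _ hl')))
    have hR1 : #(R ∩ W) ≤ 1 := by
      rw [card_le_one]
      have aux : ∀ l ∈ R ∩ W, ∀ l' ∈ R ∩ W, ¬ x l < x l' := fun l hl l' hl' hlt =>
        key l' (mem_inter.1 hl').2
          (hRh l (mem_inter.1 hl).1 l' (hR (mem_inter.1 hl').1) hlt)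
      intro l hl l' hl'
      exact hx (hR (mem_inter.1 hl).1) (hR (mem_inter.1 hl').1)
        (le_antisymm (not_lt.1 (aux _ hl' _ hl)) (not_lt.1 (aux _ hl _ hl')))
    exact (card_union_le _ _).trans (by omega)

end Quadrants

section EdgeColoring

variable {α : Type*} [DecidableEq α]

theorem exists_edge_coloring_of_regular {q : ℕ} (b₁ b₂ : α → Fin q) (k : ℕ) (V : Finset α)
    (h₁ : ∀ j, #(V.filter fun p => b₁ p = j) = k) (h₂ : ∀ j, #(V.filter fun p => b₂ p = j) = k) :
    ∃ c : α → ℕ, (∀ p ∈ V, c p < k) ∧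
      ∀ p ∈ V, ∀ p' ∈ V, c p = c p' → (b₁ p = b₁ p' ∨ b₂ p = b₂ p') → p = p' := by
  induction k generalizing V with
  | zero =>
    have : V = ∅ := eq_empty_of_forall_notMem fun p hp => by
      have := h₁ (b₁ p)
      rw [card_eq_zero, filter_eq_empty_iff] at this
      exact this hp rfl
    subst this
    exact ⟨fun _ => 0, by simp, by simp⟩
  | succ k ih =>
    set t : Fin q → Finset (Fin q) := fun j => (V.filter fun p => b₁ p = j).image b₂ with ht
    have fib : ∀ b : α → Fin q, (∀ j, #(V.filter fun p => b p = j) = k + 1) →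
        ∀ s : Finset (Fin q), #(V.filter fun p => b p ∈ s) = #s * (k + 1) := by
      intro b hb s
      have hmaps : Set.MapsTo b (V.filter fun p => b p ∈ s) s := fun p hp =>
        (mem_filter.1 (mem_coe.1 hp)).2
      rw [card_eq_sum_card_fiberwise hmaps, ← smul_eq_mul, ← sum_const]
      refine sum_congr rfl fun j hj => ?_
      rw [← hb j, filter_filter]
      congr 1
      ext p
      simp only [mem_filter]
      constructor
      · rintro ⟨h1, -, h2⟩; exact ⟨h1, h2⟩
      · rintro ⟨h1, h2⟩; exact ⟨h1, h2 ▸ hj, h2⟩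
    have hall : ∀ s : Finset (Fin q), #s ≤ #(s.biUnion t) := by
      intro s
      have h : #(V.filter fun p => b₁ p ∈ s) ≤ #(V.filter fun p => b₂ p ∈ s.biUnion t) := by
        refine card_le_card (monotone_filter_right _ fun p hp hps => ?_)
        exact mem_biUnion.2 ⟨_, hps, mem_image_of_mem _ (mem_filter.2 ⟨hp, rfl⟩)⟩
      rw [fib b₁ h₁, fib b₂ h₂] at h
      exact Nat.le_of_mul_le_mul_right h (by omega)
    obtain ⟨φ, hφ, hφt⟩ := (all_card_le_biUnion_card_iff_exists_injective t).1 hall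
    have hφs := (Finite.injective_iff_surjective.1 hφ)
    have hex : ∀ j, ∃ p ∈ V, b₁ p = j ∧ b₂ p = φ j := by
      intro j
      obtain ⟨p, hp, hpj⟩ := mem_image.1 (hφt j)
      rw [mem_filter] at hp
      exact ⟨p, hp.1, hp.2, hpj⟩
    choose e heV he1 he2 using hex
    have hX1 : ∀ j, (V \ univ.image e).filter (fun p => b₁ p = j) =
        (V.filter fun p => b₁ p = j).erase (e j) := by
      intro j
      ext p
      simp only [mem_filter, mem_sdiff, mem_image, mem_univ, true_and, not_exists, mem_erase]
      constructor
      · rintro ⟨⟨h, h'⟩, rfl⟩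
        exact ⟨fun h => h' _ h.symm, h, rfl⟩
      · rintro ⟨h, h', rfl⟩
        exact ⟨⟨h', fun i hi => h (by rw [← hi, he1])⟩, rfl⟩
    have hX2 : ∀ j, (V \ univ.image e).filter (fun p => b₂ p = φ j) =
        (V.filter fun p => b₂ p = φ j).erase (e j) := by
      intro j
      ext p
      simp only [mem_filter, mem_sdiff, mem_image, mem_univ, true_and, not_exists, mem_erase]
      constructor
      · rintro ⟨⟨h, h'⟩, h2⟩
        exact ⟨fun h => h' _ h.symm, h, h2⟩
      · rintro ⟨h, h', h2⟩
        refine ⟨⟨h', fun i hi => h ?_⟩, h2⟩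
        have : φ i = φ j := by rw [← h2, ← hi, he2]
        rw [← hi, hφ this]
    obtain ⟨c, hc, hc'⟩ := ih (V \ univ.image e)
      (fun j => by
        rw [hX1, card_erase_of_mem (mem_filter.2 ⟨heV j, he1 j⟩), h₁]; rfl)
      (fun j => by
        obtain ⟨i, rfl⟩ := hφs j
        rw [hX2, card_erase_of_mem (mem_filter.2 ⟨heV i, he2 i⟩), h₂]; rfl)
    refine ⟨fun p => if p ∈ univ.image e then k else c p, fun p hp => ?_, ?_⟩
    · dsimp only
      split_ifs with h
      · omega
      · have := hc p (mem_sdiff.2 ⟨hp, h⟩); omega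
    · intro p hp p' hp' hcc hb
      dsimp only at hcc
      split_ifs at hcc with h h' h'
      · obtain ⟨i, -, rfl⟩ := mem_image.1 h
        obtain ⟨j, -, rfl⟩ := mem_image.1 h'
        congr 1
        rcases hb with hb | hb
        · rwa [he1, he1] at hb
        · rw [he2, he2] at hb
          exact hφ hb
      · have := hc p' (mem_sdiff.2 ⟨hp', h'⟩); omega
      · have := hc p (mem_sdiff.2 ⟨hp, h⟩); omega
      · exact hc' p (mem_sdiff.2 ⟨hp, h⟩) p' (mem_sdiff.2 ⟨hp', h'⟩) hcc hb

section Rank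

variable {α : Type*}

/-- The number of points of `V` that precede `p` in the order given by `f`. -/
noncomputable def rankIn (f : α → ℝ) (V : Finset α) (p : α) : ℕ := #(V.filter fun q => f q < f p)

theorem rankIn_lt_of_lt {f : α → ℝ} {V : Finset α} {p q : α} (hp : p ∈ V) (h : f p < f q) :
    rankIn f V p < rankIn f V q := by
  refine card_lt_card ((ssubset_iff_of_subset
    (monotone_filter_right _ fun r _ hr => hr.trans h)).2 ⟨p, mem_filter.2 ⟨hp, h⟩, by simp⟩)

theorem rankIn_lt_card {f : α → ℝ} {V : Finset α} {p : α} (hp : p ∈ V) : rankIn f V p < #V :=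
  card_lt_card ((ssubset_iff_of_subset (filter_subset _ _)).2 ⟨p, hp, by simp⟩)

theorem injOn_rankIn {f : α → ℝ} {V : Finset α} (hf : Set.InjOn f V) :
    Set.InjOn (rankIn f V) V := by
  intro p hp q hq h
  rcases lt_trichotomy (f p) (f q) with h' | h' | h'
  · exact absurd h (rankIn_lt_of_lt hp h').ne
  · exact hf hp hq h'
  · exact absurd h (rankIn_lt_of_lt hq h').ne'

theorem exists_rankIn_eq {f : α → ℝ} {V : Finset α} (hf : Set.InjOn f V) {r : ℕ} (hr : r < #V) :
    ∃ p ∈ V, rankIn f V p = r := by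
  classical
  have : V.image (rankIn f V) = range #V := by
    refine eq_of_subset_of_card_le (fun i hi => ?_) ?_
    · obtain ⟨p, hp, rfl⟩ := mem_image.1 hi
      exact mem_range.2 (rankIn_lt_card hp)
    · rw [card_range, card_image_of_injOn (injOn_rankIn hf)]
  simpa [← this] using mem_range.2 hr

theorem exists_full_block {f : α → ℝ} {V : Finset α} (hf : Set.InjOn f V) {s : ℕ} (hs : 1 ≤ s)
    {a b : ℝ} (h : 2 * s - 1 ≤ #(V.filter fun p => a ≤ f p ∧ f p ≤ b)) :
    ∃ t, #(V.filter fun p => rankIn f V p / s = t) = s ∧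
      ∀ p ∈ V, rankIn f V p / s = t → a ≤ f p ∧ f p ≤ b := by
  set I := V.filter fun p => a ≤ f p ∧ f p ≤ b with hI
  have hne : I.Nonempty := card_pos.1 (by omega)
  obtain ⟨p₀, hp₀, hmin⟩ := exists_min_image I (rankIn f V) hne
  obtain ⟨p₁, hp₁, hmax⟩ := exists_max_image I (rankIn f V) hne
  have hcard : #I ≤ #(Icc (rankIn f V p₀) (rankIn f V p₁)) :=
    card_le_card_of_injOn (rankIn f V) (fun p hp => by
      rw [coe_Icc]; exact ⟨hmin p hp, hmax p hp⟩)
      ((injOn_rankIn hf).mono (filter_subset _ _))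
  rw [Nat.card_Icc] at hcard
  have hIV : ∀ p ∈ I, p ∈ V ∧ a ≤ f p ∧ f p ≤ b := fun p hp => mem_filter.1 hp
  set r₀ := rankIn f V p₀
  set r₁ := rankIn f V p₁
  have hr₁ : r₁ < #V := rankIn_lt_card (hIV p₁ hp₁).1
  obtain ⟨t, htdef⟩ : ∃ t, t = (r₀ + s - 1) / s := ⟨_, rfl⟩
  have ht0 : r₀ ≤ t * s := by
    have := Nat.lt_div_mul_add (a := r₀ + s - 1) hs
    rw [← htdef] at this
    omega
  have ht1 : t * s ≤ r₀ + s - 1 := htdef ▸ Nat.div_mul_le_self _ _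
  have hblock : ∀ p, rankIn f V p / s = t ↔ t * s ≤ rankIn f V p ∧ rankIn f V p < t * s + s := by
    intro p
    rw [Nat.div_eq_iff hs]
    omega
  refine ⟨t, ?_, fun p hp hpt => ?_⟩
  · refine le_antisymm ?_ ?_
    · have : #(V.filter fun p => rankIn f V p / s = t) ≤ #(Ico (t * s) (t * s + s)) :=
        card_le_card_of_injOn (rankIn f V) (fun p hp => by
          rw [coe_Ico]; exact (hblock p).1 (mem_filter.1 hp).2)
          ((injOn_rankIn hf).mono (filter_subset _ _))
      simpa using this
    · have : #(Ico (t * s) (t * s + s)) ≤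
          #((V.filter fun p => rankIn f V p / s = t).image (rankIn f V)) := by
        refine card_le_card fun r hr => ?_
        rw [mem_Ico] at hr
        obtain ⟨p, hp, rfl⟩ := exists_rankIn_eq hf (r := r) (by omega)
        exact mem_image_of_mem _ (mem_filter.2 ⟨hp, (hblock p).2 hr⟩)
      simpa using this.trans card_image_le
  · rw [hblock] at hpt
    constructor
    · by_contra! hlt
      have := rankIn_lt_of_lt hp (hlt.trans_le (hIV p₀ hp₀).2.1)
      omega
    · by_contra! hlt
      have := rankIn_lt_of_lt (hIV p₁ hp₁).1 ((hIV p₁ hp₁).2.2.trans_lt hlt)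
      omega

end Rank

theorem exists_injOn_real (V : Finset α) : ∃ f : α → ℝ, Set.InjOn f V := by
  refine ⟨fun p => if h : p ∈ V then ((V.equivFin ⟨p, h⟩ : ℕ) : ℝ) else 0, fun p hp q hq h => ?_⟩
  have hp' : p ∈ V := hp
  have hq' : q ∈ V := hq
  simpa [hp', hq', Fin.val_inj] using h

theorem exists_injOn_prod_of_card_le {β : Type*} [DecidableEq β] (V : Finset α) (b : α → β)
    {k q : ℕ} (hk : ∀ j, #(V.filter fun p => b p = j) ≤ k) (hq : #V ≤ q) :
    ∃ g : V → Fin q × Fin k, Function.Injective g ∧ ∀ p p' : V, b p = b p' ↔ (g p).1 = (g p').1 := by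
  obtain ⟨f, hf⟩ := exists_injOn_real V
  have hqi : #(V.image b) ≤ q := card_image_le.trans hq
  have hr : ∀ p : V, rankIn f (V.filter fun p' => b p' = b p) p < k := fun p =>
    (rankIn_lt_card (V := V.filter fun p' => b p' = b p)
      (mem_filter.2 ⟨p.2, rfl⟩)).trans_le (hk _)
  have h1 : ∀ p p' : V, b p = b p' ↔
      Fin.castLE hqi ((V.image b).equivFin ⟨b p, mem_image_of_mem b p.2⟩) =
      Fin.castLE hqi ((V.image b).equivFin ⟨b p', mem_image_of_mem b p'.2⟩) := by
    intro p p'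
    simp [(Fin.castLE_injective hqi).eq_iff]
  refine ⟨fun p => ⟨Fin.castLE hqi ((V.image b).equivFin ⟨b p, mem_image_of_mem b p.2⟩),
    ⟨_, hr p⟩⟩, ?_, h1⟩
  intro p p' h
  simp only [Prod.mk.injEq, Fin.mk.injEq] at h
  have hb := (h1 p p').2 h.1
  have h2 := h.2
  rw [hb] at h2
  exact Subtype.ext (injOn_rankIn (V := V.filter fun x => b x = b p')
    (hf.mono (filter_subset _ _)) (mem_filter.2 ⟨p.2, hb⟩) (mem_filter.2 ⟨p'.2, rfl⟩) h2)

/-- Kőnig's edge colouring theorem: the points are the edges of a bipartite multigraph, the vertex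
classes of which are the values of `b₁` and of `b₂`. -/
theorem exists_edge_coloring {β γ : Type*} [DecidableEq β] [DecidableEq γ] (V : Finset α)
    (b₁ : α → β) (b₂ : α → γ) {k : ℕ} (hk : 1 ≤ k) (h₁ : ∀ j, #(V.filter fun p => b₁ p = j) ≤ k)
    (h₂ : ∀ j, #(V.filter fun p => b₂ p = j) ≤ k) :
    ∃ c : α → Fin k, ∀ p ∈ V, ∀ p' ∈ V, c p = c p' → (b₁ p = b₁ p' ∨ b₂ p = b₂ p') → p = p' := by
  obtain ⟨g₁, hg₁, hb₁⟩ := exists_injOn_prod_of_card_le V b₁ h₁ le_rfl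
  obtain ⟨g₂, hg₂, hb₂⟩ := exists_injOn_prod_of_card_le V b₂ h₂ le_rfl
  obtain ⟨σ, hσ⟩ : ∃ σ : Fin #V × Fin k ≃ Fin #V × Fin k, ∀ p, σ (g₁ p) = g₂ p := by
    have : Fintype.card {x // x ∈ Set.range g₁} = Fintype.card {x // x ∈ Set.range g₂} := by
      rw [Set.card_range_of_injective hg₁, Set.card_range_of_injective hg₂]
    refine ⟨((Equiv.ofInjective g₁ hg₁).symm.trans (Equiv.ofInjective g₂ hg₂)).extendSubtype,
      fun p => ?_⟩
    rw [Equiv.extendSubtype_apply_of_mem _ _ ⟨p, rfl⟩]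
    have : (Equiv.ofInjective g₁ hg₁).symm ⟨g₁ p, p, rfl⟩ = p :=
      Equiv.ofInjective_symm_apply hg₁ p
    simp [this]
  have hfst : ∀ j : Fin #V,
      #((univ : Finset (Fin #V × Fin k)).filter fun x => x.1 = j) = k := by
    intro j
    have : ((univ : Finset (Fin #V × Fin k)).filter fun x => x.1 = j) = {j} ×ˢ univ := by
      ext ⟨x, y⟩
      simp only [mem_filter, mem_univ, true_and, mem_product, mem_singleton, and_true]
    simp [this]
  obtain ⟨c, hc, hc'⟩ := exists_edge_coloring_of_regular (α := Fin #V × Fin k)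
    Prod.fst (fun x => (σ x).1) k univ hfst (fun j => by
      refine Eq.trans ?_ (hfst j)
      exact card_bij (fun x _ => σ x) (by simp) (by simp)
        (fun x hx => ⟨σ.symm x, by simpa using hx, by simp⟩))
  refine ⟨fun p => if h : p ∈ V then ⟨c (g₁ ⟨p, h⟩), hc _ (mem_univ _)⟩ else ⟨0, hk⟩, ?_⟩
  intro p hp p' hp' hcc hb
  simp only [hp, hp', dif_pos, Fin.mk.injEq] at hcc
  have := hc' _ (mem_univ _) _ (mem_univ _) hcc (by
    rw [hσ, hσ]
    exact hb.imp (hb₁ ⟨p, hp⟩ ⟨p', hp'⟩).1 (hb₂ ⟨p, hp⟩ ⟨p', hp'⟩).1)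
  exact congrArg Subtype.val (hg₁ this)

theorem exists_coloring_of_two_partitions (V : Finset α) (b₁ b₂ : α → ℕ) {k : ℕ} (hk : 1 ≤ k) :
    ∃ c : α → Fin k,
      (∀ j, k ≤ #(V.filter fun p => b₁ p = j) → ∀ i, ∃ p ∈ V, b₁ p = j ∧ c p = i) ∧
      (∀ j, k ≤ #(V.filter fun p => b₂ p = j) → ∀ i, ∃ p ∈ V, b₂ p = j ∧ c p = i) := by
  obtain ⟨f, hf⟩ := exists_injOn_real V
  have small : ∀ (b : α → ℕ) (j : ℕ × ℕ),
      #(V.filter fun p => (b p, rankIn f (V.filter fun q => b q = b p) p / k) = j) ≤ k := by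
    rintro b ⟨j, t⟩
    have : #(V.filter fun p => (b p, rankIn f (V.filter fun q => b q = b p) p / k) = (j, t)) ≤
        #(Ico (t * k) (t * k + k)) := by
      refine card_le_card_of_injOn (rankIn f (V.filter fun q => b q = j)) ?_ ?_
      · intro p hp
        simp only [coe_filter, Prod.mk.injEq] at hp
        obtain ⟨-, rfl, rfl⟩ := hp
        rw [coe_Ico]
        exact ⟨Nat.div_mul_le_self _ _, Nat.lt_div_mul_add hk⟩
      · refine (injOn_rankIn (hf.mono (filter_subset _ _))).mono fun p hp => ?_
        simp only [coe_filter, Prod.mk.injEq] at hp ⊢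
        exact ⟨hp.1, hp.2.1⟩
    simpa using this
  obtain ⟨c, hc⟩ := exists_edge_coloring V
    (fun p => (b₁ p, rankIn f (V.filter fun q => b₁ q = b₁ p) p / k))
    (fun p => (b₂ p, rankIn f (V.filter fun q => b₂ q = b₂ p) p / k)) hk (small b₁) (small b₂)
  have main : ∀ b : α → ℕ,
      (∀ p ∈ V, ∀ p' ∈ V, c p = c p' →
        (b p, rankIn f (V.filter fun q => b q = b p) p / k) =
        (b p', rankIn f (V.filter fun q => b q = b p') p' / k) → p = p') →
      ∀ j, k ≤ #(V.filter fun p => b p = j) → ∀ i, ∃ p ∈ V, b p = j ∧ c p = i := by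
    intro b hb j hj i
    have hF : Set.InjOn f (V.filter fun p => b p = j) := hf.mono (filter_subset _ _)
    choose g hgm hgr using fun r : Fin k => exists_rankIn_eq hF (r.2.trans_le hj)
    have hinj : Function.Injective fun r : Fin k => c (g r) := by
      intro r s hrs
      have h1 := mem_filter.1 (hgm r)
      have h2 := mem_filter.1 (hgm s)
      have := hb _ h1.1 _ h2.1 hrs (by
        rw [h1.2, h2.2, hgr r, hgr s, Nat.div_eq_of_lt r.2, Nat.div_eq_of_lt s.2])
      have h3 := hgr r
      rw [this, hgr s] at h3
      exact Fin.ext h3.symm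
    obtain ⟨r, hr⟩ := Finite.injective_iff_surjective.1 hinj i
    have h1 := mem_filter.1 (hgm r)
    exact ⟨_, h1.1, h1.2, hr⟩
  exact ⟨c, main b₁ fun p hp p' hp' h h' => hc p hp p' hp' h (.inl h'),
    main b₂ fun p hp p' hp' h h' => hc p hp p' hp' h (.inr h')⟩

theorem exists_coloring_two_strips {f g : α → ℝ} {V : Finset α} (hf : Set.InjOn f V)
    (hg : Set.InjOn g V) {k : ℕ} (hk : 1 ≤ k) :
    ∃ c : α → Fin k, ∀ a b i,
      (2 * k - 1 ≤ #(V.filter fun p => a ≤ f p ∧ f p ≤ b) →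
        ∃ p ∈ V, (a ≤ f p ∧ f p ≤ b) ∧ c p = i) ∧
      (2 * k - 1 ≤ #(V.filter fun p => a ≤ g p ∧ g p ≤ b) →
        ∃ p ∈ V, (a ≤ g p ∧ g p ≤ b) ∧ c p = i) := by
  obtain ⟨c, h1, h2⟩ := exists_coloring_of_two_partitions V (fun p => rankIn f V p / k)
    (fun p => rankIn g V p / k) hk
  refine ⟨c, fun a b i => ⟨fun h => ?_, fun h => ?_⟩⟩
  · obtain ⟨t, ht, ht'⟩ := exists_full_block hf hk h
    obtain ⟨p, hp, hpt, hpi⟩ := h1 t ht.ge i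
    exact ⟨p, hp, ht' p hp hpt, hpi⟩
  · obtain ⟨t, ht, ht'⟩ := exists_full_block hg hk h
    obtain ⟨p, hp, hpt, hpi⟩ := h2 t ht.ge i
    exact ⟨p, hp, ht' p hp hpt, hpi⟩

end EdgeColoring

section Strips

variable {α : Type*}

theorem card_filter_rankIn_div_le {f : α → ℝ} {V : Finset α} (hf : Set.InjOn f V) {s : ℕ}
    (hs : 1 ≤ s) (t : ℕ) : #(V.filter fun p => rankIn f V p / s = t) ≤ s := by
  have : #(V.filter fun p => rankIn f V p / s = t) ≤ #(Ico (t * s) (t * s + s)) := by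
    refine card_le_card_of_injOn (rankIn f V) (fun p hp => ?_)
      ((injOn_rankIn hf).mono (filter_subset _ _))
    obtain ⟨-, rfl⟩ := mem_filter.1 (mem_coe.1 hp)
    rw [coe_Ico]
    exact ⟨Nat.div_mul_le_self _ _, Nat.lt_div_mul_add hs⟩
  simpa using this

/-- A set with at most one point in each `s`-block has at most `j` points in each `s * j`-block. -/
theorem card_filter_block_le {f : α → ℝ} {V B : Finset α} {s j : ℕ} (hj : 1 ≤ j)
    (hB : ∀ p ∈ B, ∀ q ∈ B, rankIn f V p / s = rankIn f V q / s → p = q) (t : ℕ) :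
    #(B.filter fun p => rankIn f V p / (s * j) = t) ≤ j := by
  have : #(B.filter fun p => rankIn f V p / (s * j) = t) ≤ #(Ico (t * j) (t * j + j)) := by
    refine card_le_card_of_injOn (fun p => rankIn f V p / s) (fun p hp => ?_) ?_
    · obtain ⟨-, rfl⟩ := mem_filter.1 (mem_coe.1 hp)
      rw [coe_Ico, ← Nat.div_div_eq_div_mul]
      exact ⟨Nat.div_mul_le_self _ _, Nat.lt_div_mul_add hj⟩
    · intro p hp q hq h
      exact hB p (mem_filter.1 (mem_coe.1 hp)).1 q (mem_filter.1 (mem_coe.1 hq)).1 h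
  simpa using this

variable [DecidableEq α]

/-- A splitting of the points into four classes, each of which has at most one point in every pair
of `f`-consecutive points, in every pair of `g`-consecutive points, and in every quadruple of
`h`-consecutive points. -/
theorem exists_four_classes {f g h : α → ℝ} {V : Finset α} (hf : Set.InjOn f V)
    (hg : Set.InjOn g V) (hh : Set.InjOn h V) :
    ∃ d : α → Fin 2 × Fin 2, ∀ p ∈ V, ∀ q ∈ V, d p = d q →
      (rankIn f V p / 2 = rankIn f V q / 2 ∨ rankIn g V p / 2 = rankIn g V q / 2 ∨
        rankIn h V p / 4 = rankIn h V q / 4) → p = q := by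
  obtain ⟨c, hc⟩ := exists_edge_coloring V (fun p => rankIn f V p / 2)
    (fun p => rankIn h V p / 2) one_le_two (card_filter_rankIn_div_le hf one_le_two)
    (card_filter_rankIn_div_le hh one_le_two)
  obtain ⟨e, he⟩ := exists_edge_coloring V (fun p => rankIn g V p / 2)
    (fun p => (rankIn h V p / 4, c p)) one_le_two (card_filter_rankIn_div_le hg one_le_two) (by
      rintro ⟨t, i⟩
      have : V.filter (fun p => (rankIn h V p / 4, c p) = (t, i)) =
          (V.filter fun p => c p = i).filter fun p => rankIn h V p / (2 * 2) = t := by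
        rw [filter_filter]
        exact filter_congr fun p _ => by simp [Prod.mk.injEq, and_comm]
      rw [this]
      refine card_filter_block_le one_le_two (fun p hp q hq hpq => ?_) t
      rw [mem_filter] at hp hq
      exact hc p hp.1 q hq.1 (hp.2.trans hq.2.symm) (.inr hpq))
  refine ⟨fun p => (c p, e p), fun p hp q hq hpq hr => ?_⟩
  rw [Prod.mk.injEq] at hpq
  rcases hr with hr | hr | hr
  · exact hc p hp q hq hpq.1 (.inl hr)
  · exact he p hp q hq hpq.2 (.inl hr)
  · exact he p hp q hq hpq.2 (.inr (by simp [hr, hpq.1]))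

theorem exists_coloring_three_strips {f g h : α → ℝ} {V : Finset α} (hf : Set.InjOn f V)
    (hg : Set.InjOn g V) (hh : Set.InjOn h V) {k : ℕ} (hk : 2 ≤ k) :
    ∃ c : α → Fin k, ∀ a b i,
      (4 * k - 1 ≤ #(V.filter fun p => a ≤ f p ∧ f p ≤ b) →
        ∃ p ∈ V, (a ≤ f p ∧ f p ≤ b) ∧ c p = i) ∧
      (4 * k - 1 ≤ #(V.filter fun p => a ≤ g p ∧ g p ≤ b) →
        ∃ p ∈ V, (a ≤ g p ∧ g p ≤ b) ∧ c p = i) ∧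
      (8 * k - 9 ≤ #(V.filter fun p => a ≤ h p ∧ h p ≤ b) →
        ∃ p ∈ V, (a ≤ h p ∧ h p ≤ b) ∧ c p = i) := by
  obtain ⟨d, hd⟩ := exists_four_classes hf hg hh
  set B := V.filter fun p => d p = 0 with hB
  have memB : ∀ {p}, p ∈ B ↔ p ∈ V ∧ d p = 0 := by simp [hB]
  obtain ⟨c₁, hc1, hc2⟩ := exists_coloring_of_two_partitions (V \ B)
    (fun p => rankIn f V p / (2 * k)) (fun p => rankIn g V p / (2 * k)) (k := k) (by omega)
  -- the full blocks of size `2 k` have at least `k` points outside of `B`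
  have hA : ∀ r : α → ℕ, (∀ t, #(B.filter fun p => r p = t) ≤ k) →
      ∀ t, #(V.filter fun p => r p = t) = 2 * k → k ≤ #((V \ B).filter fun p => r p = t) := by
    intro r hr t ht
    have h1 : (V \ B).filter (fun p => r p = t) =
        (V.filter fun p => r p = t) \ (B.filter fun p => r p = t) := by
      ext p; simp only [mem_filter, mem_sdiff]; tauto
    have h2 := le_card_sdiff (B.filter fun p => r p = t) (V.filter fun p => r p = t)
    have h3 := hr t
    rw [h1]
    omega
  have hAf := hA (fun p => rankIn f V p / (2 * k)) (card_filter_block_le (by omega)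
    fun p hp q hq hpq => hd p (memB.1 hp).1 q (memB.1 hq).1
      ((memB.1 hp).2.trans (memB.1 hq).2.symm) (.inl hpq))
  have hAg := hA (fun p => rankIn g V p / (2 * k)) (card_filter_block_le (by omega)
    fun p hp q hq hpq => hd p (memB.1 hp).1 q (memB.1 hq).1
      ((memB.1 hp).2.trans (memB.1 hq).2.symm) (.inr (.inl hpq)))
  obtain ⟨K, rfl⟩ : ∃ K, k = K + 1 := ⟨k - 1, by omega⟩
  -- each class has at most `K` points in each `h`-block of size `4 K`
  have hclass : ∀ t j, #((V.filter fun p => d p = j).filter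
      fun p => rankIn h V p / (4 * K) = t) ≤ K := fun t j =>
    card_filter_block_le (by omega) (fun p hp q hq hpq => by
      rw [mem_filter] at hp hq
      exact hd p hp.1 q hq.1 (hp.2.trans hq.2.symm) (.inr (.inr hpq))) t
  have hfull : ∀ t, #(V.filter fun p => rankIn h V p / (4 * K) = t) = 4 * K →
      K ≤ #(B.filter fun p => rankIn h V p / (4 * K) = t) := by
    intro t ht
    have h1 := card_eq_sum_card_fiberwise (f := d) (t := univ)
      (s := V.filter fun p => rankIn h V p / (4 * K) = t) (by simp [Set.MapsTo])
    have h2 : ∀ j, #((V.filter fun p => rankIn h V p / (4 * K) = t).filter fun p => d p = j) =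
        #((V.filter fun p => d p = j).filter fun p => rankIn h V p / (4 * K) = t) := fun j => by
      rw [filter_comm]
    rw [ht, Fintype.sum_prod_type, Fin.sum_univ_two, Fin.sum_univ_two, Fin.sum_univ_two] at h1
    simp only [h2] at h1
    have h3 := hclass t (0, 1)
    have h4 := hclass t (1, 0)
    have h5 := hclass t (1, 1)
    have h6 : (V.filter fun p => d p = (0, 0)) = B := rfl
    rw [h6] at h1
    omega
  have hblock : ∀ t, ∃ c₂ : α → Fin (K + 1),
      #(V.filter fun p => rankIn h V p / (4 * K) = t) = 4 * K → ∀ i, ∃ p ∈ V,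
        rankIn h V p / (4 * K) = t ∧ (if p ∈ B then c₂ p else c₁ p) = i := by
    intro t
    by_cases ht : #(V.filter fun p => rankIn h V p / (4 * K) = t) = 4 * K
    · have hBK := hfull t ht
      have hBK' := hclass t 0
      obtain ⟨a, ha⟩ : ((V.filter fun p => rankIn h V p / (4 * K) = t) \
          (B.filter fun p => rankIn h V p / (4 * K) = t)).Nonempty := by
        rw [← card_pos]
        have := le_card_sdiff (B.filter fun p => rankIn h V p / (4 * K) = t)
          (V.filter fun p => rankIn h V p / (4 * K) = t)
        change #(B.filter _) ≤ K at hBK'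
        omega
      simp only [mem_sdiff, mem_filter, not_and] at ha
      obtain ⟨⟨haV, hat⟩, haB⟩ := ha
      have haB : a ∉ B := fun h' => haB h' hat
      obtain ⟨T, hT, hTc⟩ := exists_subset_card_eq hBK
      have hcard : #T = Fintype.card {i // i ≠ c₁ a} := by
        simp [Fintype.card_subtype_compl, hTc]
      let e := (T.equivFinOfCardEq hcard).trans (Fintype.equivFin _).symm
      refine ⟨fun p => if hp : p ∈ T then (e ⟨p, hp⟩ : Fin (K + 1)) else 0, fun _ i => ?_⟩
      by_cases hi : i = c₁ a
      · exact ⟨a, haV, hat, by simp [haB, hi]⟩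
      · obtain ⟨⟨p, hp⟩, hpi⟩ := e.surjective ⟨i, hi⟩
        have hpB := mem_filter.1 (hT hp)
        exact ⟨p, (memB.1 hpB.1).1, hpB.2, by simp [hpB.1, hp, hpi]⟩
    · exact ⟨fun _ => 0, fun h' => absurd h' ht⟩
  choose c₂ hc₂ using hblock
  refine ⟨fun p => if p ∈ B then c₂ (rankIn h V p / (4 * K)) p else c₁ p, fun a b i => ⟨?_, ?_, ?_⟩⟩
  · intro hab
    obtain ⟨t, ht, ht'⟩ := exists_full_block hf (s := 2 * (K + 1)) (a := a) (b := b)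
      (by omega) (by omega)
    obtain ⟨p, hp, hpt, hpi⟩ := hc1 t (hAf t ht) i
    rw [mem_sdiff] at hp
    exact ⟨p, hp.1, ht' p hp.1 hpt, by simpa [hp.2] using hpi⟩
  · intro hab
    obtain ⟨t, ht, ht'⟩ := exists_full_block hg (s := 2 * (K + 1)) (a := a) (b := b)
      (by omega) (by omega)
    obtain ⟨p, hp, hpt, hpi⟩ := hc2 t (hAg t ht) i
    rw [mem_sdiff] at hp
    exact ⟨p, hp.1, ht' p hp.1 hpt, by simpa [hp.2] using hpi⟩
  · intro hab
    obtain ⟨t, ht, ht'⟩ := exists_full_block hh (s := 4 * K) (a := a) (b := b)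
      (by omega) (by omega)
    obtain ⟨p, hp, hpt, hpi⟩ := hc₂ t ht i
    exact ⟨p, hp, ht' p hp hpt, by simpa only [hpt] using hpi⟩

end Strips

section Bottomless

variable {α : Type*}

theorem exists_initial_segment (x : α → ℝ) (I : Finset α) (hx : Set.InjOn x I) (n : ℕ)
    (h : n ≤ #I) : ∃ J ⊆ I, #J = n ∧ ∀ p ∈ J, ∀ q ∈ I, q ∉ J → x p < x q := by
  rcases Nat.eq_zero_or_pos n with rfl | hn
  · exact ⟨∅, by simp⟩
  obtain ⟨t, ht⟩ := exists_threshold x I hx n hn h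
  refine ⟨_, filter_subset _ _, ht, fun p hp q hq hqJ => ?_⟩
  rw [mem_filter] at hp hqJ
  exact hp.2.trans_lt (not_le.1 fun h => hqJ ⟨hq, h⟩)

variable [DecidableEq α]

/-- Between any two points of the same colour there are at least `k - 1` further points. -/
def IsSpread (x : α → ℝ) (V : Finset α) {k : ℕ} (c : α → Option (Fin k)) : Prop :=
  ∀ p ∈ V, ∀ q ∈ V, x p < x q → c p = c q → c p ≠ none →
    k ≤ #(V.filter fun s => x p < x s ∧ x s < x q) + 1

theorem IsSpread.exists_extension {x : α → ℝ} {V : Finset α} (hx : Set.InjOn x V) {k : ℕ}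
    (c : α → Option (Fin k)) (hc : IsSpread x V c) :
    ∃ c' : α → Option (Fin k), (∀ p, c p ≠ none → c' p = c p) ∧ IsSpread x V c' ∧
      ∀ a b, 3 * k - 2 ≤ #(V.filter fun p => a ≤ x p ∧ x p ≤ b) →
        ∀ i, ∃ p ∈ V, (a ≤ x p ∧ x p ≤ b) ∧ c' p = some i := by
  induction hN : #(V.filter fun p => c p = none) using Nat.strong_induction_on generalizing c with
  | _ N ih =>
  subst hN
  by_cases hgood : ∀ a b, 3 * k - 2 ≤ #(V.filter fun p => a ≤ x p ∧ x p ≤ b) →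
      ∀ i, ∃ p ∈ V, (a ≤ x p ∧ x p ≤ b) ∧ c p = some i
  · exact ⟨c, fun _ _ => rfl, hc, hgood⟩
  push Not at hgood
  obtain ⟨a, b, hab, i, hi⟩ := hgood
  have hk : 1 ≤ k := i.pos
  set I := V.filter fun p => a ≤ x p ∧ x p ≤ b with hI
  have hIV : I ⊆ V := filter_subset _ _
  obtain ⟨A, hAI, hAc, hA⟩ := exists_initial_segment x I (hx.mono hIV) (k - 1) (by omega)
  have hIA := card_sdiff_add_card_inter I A
  rw [inter_eq_right.2 hAI] at hIA
  obtain ⟨M, hMI, hMc, hM⟩ := exists_initial_segment x (I \ A)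
    (hx.mono (by exact_mod_cast sdiff_subset.trans hIV)) k (by omega)
  have hIM := card_sdiff_add_card_inter (I \ A) M
  rw [inter_eq_right.2 hMI] at hIM
  have hMI' : ∀ p ∈ M, p ∈ I ∧ p ∉ A := fun p hp => mem_sdiff.1 (hMI hp)
  -- points of the middle part have different colours
  have hdiff : ∀ p ∈ M, ∀ q ∈ M, x p < x q → c p = c q → c p ≠ none → False := by
    intro p hp q hq hpq hcc hne
    have h1 := hc p (hIV (hMI' p hp).1) q (hIV (hMI' q hq).1) hpq hcc hne
    have h2 : insert p (insert q (V.filter fun s => x p < x s ∧ x s < x q)) ⊆ M := by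
      refine insert_subset hp (insert_subset hq fun s hs => ?_)
      rw [mem_filter] at hs
      have hpI := mem_filter.1 (hMI' p hp).1
      have hqI := mem_filter.1 (hMI' q hq).1
      have hsI : s ∈ I := mem_filter.2 ⟨hs.1, by linarith [hs.2.1], by linarith [hs.2.2]⟩
      have hsA : s ∉ A := fun h =>
        absurd (hA s h p (hMI' p hp).1 (hMI' p hp).2) (not_lt.2 hs.2.1.le)
      by_contra hsM
      exact absurd (hM q hq s (mem_sdiff.2 ⟨hsI, hsA⟩) hsM) (not_lt.2 hs.2.2.le)
    have h3 := card_le_card h2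
    rw [card_insert_of_notMem, card_insert_of_notMem] at h3
    · omega
    · simp
    · simp only [mem_insert, mem_filter, lt_irrefl, false_and, and_false, or_false]
      rintro rfl
      exact lt_irrefl _ hpq
  obtain ⟨q, hqM, hq⟩ : ∃ q ∈ M, c q = none := by
    by_contra! hne
    have : #M ≤ #((univ : Finset (Fin k)).erase i) := by
      refine card_le_card_of_injOn (fun p => (c p).getD i) (fun p hp => ?_) fun p hp p' hp' h => ?_
      · obtain ⟨j, hj⟩ := Option.ne_none_iff_exists'.1 (hne p hp)
        have hpI := mem_filter.1 (hMI' p hp).1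
        simp only [hj, Option.getD_some, coe_erase, coe_univ, Set.mem_sdiff, Set.mem_univ, true_and,
          Set.mem_singleton_iff]
        rintro rfl
        exact hi p hpI.1 hpI.2 hj
      · obtain ⟨j, hj⟩ := Option.ne_none_iff_exists'.1 (hne p hp)
        obtain ⟨j', hj'⟩ := Option.ne_none_iff_exists'.1 (hne p' hp')
        simp only [hj, hj', Option.getD_some] at h
        have hcc : c p = c p' := by rw [hj, hj', h]
        rcases lt_trichotomy (x p) (x p') with hlt | heq | hlt
        · exact (hdiff p hp p' hp' hlt hcc (hne p hp)).elim
        · exact hx (hIV (hMI' p hp).1) (hIV (hMI' p' hp').1) heq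
        · exact (hdiff p' hp' p hp hlt hcc.symm (hne p' hp')).elim
    rw [card_erase_of_mem (mem_univ _), card_univ, Fintype.card_fin] at this
    omega
  have hqV := hIV (hMI' q hqM).1
  have hqI := mem_filter.1 (hMI' q hqM).1
  have hout : ∀ p ∈ V, c p = some i → x p < a ∨ b < x p := by
    intro p hp hpi
    by_contra! h
    exact hi p hp h hpi
  set c₁ : α → Option (Fin k) := Function.update c q (some i) with hc₁
  have hself : c₁ q = some i := Function.update_self ..
  have hother : ∀ p, p ≠ q → c₁ p = c p := fun p hp => Function.update_of_ne hp ..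
  have hspread : IsSpread x V c₁ := by
    intro p hp p' hp' hlt hcc hne
    by_cases hpq : p = q
    · subst hpq
      have hp'q : p' ≠ p := fun e => hlt.ne (e ▸ rfl)
      rw [hself, hother p' hp'q] at hcc
      have hb : b < x p' := (hout p' hp' hcc.symm).resolve_left fun h => by linarith [hqI.2.1]
      have : (I \ A) \ M ⊆ V.filter fun s => x p < x s ∧ x s < x p' := by
        intro s hs
        rw [mem_sdiff] at hs
        have hsI := mem_filter.1 (mem_sdiff.1 hs.1).1
        exact mem_filter.2 ⟨hsI.1, hM p hqM s hs.1 hs.2, hsI.2.2.trans_lt hb⟩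
      have := card_le_card this
      omega
    · by_cases hp'q : p' = q
      · subst hp'q
        rw [hself, hother p hpq] at hcc
        have ha : x p < a := (hout p hp hcc).resolve_right fun h => by linarith [hqI.2.2]
        have : A ⊆ V.filter fun s => x p < x s ∧ x s < x p' := by
          intro s hs
          have hsI := mem_filter.1 (hAI hs)
          exact mem_filter.2 ⟨hsI.1, ha.trans_le hsI.2.1,
            hA s hs p' (hMI' p' hqM).1 (hMI' p' hqM).2⟩
        have := card_le_card this
        omega
      · rw [hother p hpq, hother p' hp'q] at hcc
        rw [hother p hpq] at hne
        exact hc p hp p' hp' hlt hcc hne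
  have hlt : #(V.filter fun p => c₁ p = none) < #(V.filter fun p => c p = none) := by
    refine card_lt_card ((ssubset_iff_of_subset fun p hp => ?_).2
      ⟨q, mem_filter.2 ⟨hqV, hq⟩, by simp [hself]⟩)
    rw [mem_filter] at hp ⊢
    have hpq : p ≠ q := fun e => by rw [e, hself] at hp; exact absurd hp.2 (by simp)
    exact ⟨hp.1, (hother p hpq) ▸ hp.2⟩
  obtain ⟨c', h1, h2, h3⟩ := ih _ hlt c₁ hspread rfl
  refine ⟨c', fun p hp => ?_, h2, h3⟩
  have hpq : p ≠ q := fun e => hp (e ▸ hq)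
  rw [h1 p (by rwa [hother p hpq]), hother p hpq]

theorem exists_coloring_bottomless {x y : α → ℝ} {V : Finset α} (hx : Set.InjOn x V)
    (hy : Set.InjOn y V) {k : ℕ} (hk : 1 ≤ k) :
    ∃ c : α → Fin k, ∀ a₁ a₂ b,
      3 * k - 2 ≤ #(V.filter fun p => a₁ ≤ x p ∧ x p ≤ a₂ ∧ y p ≤ b) →
        ∀ i, ∃ p ∈ V, (a₁ ≤ x p ∧ x p ≤ a₂ ∧ y p ≤ b) ∧ c p = i := by
  suffices h : ∃ c : α → Option (Fin k), IsSpread x V c ∧ (∀ p ∉ V, c p = none) ∧ ∀ a₁ a₂ b,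
      3 * k - 2 ≤ #(V.filter fun p => a₁ ≤ x p ∧ x p ≤ a₂ ∧ y p ≤ b) →
        ∀ i, ∃ p ∈ V, (a₁ ≤ x p ∧ x p ≤ a₂ ∧ y p ≤ b) ∧ c p = some i by
    obtain ⟨c, -, -, hc⟩ := h
    refine ⟨fun p => (c p).getD ⟨0, hk⟩, fun a₁ a₂ b hab i => ?_⟩
    obtain ⟨p, hp, hpab, hpi⟩ := hc a₁ a₂ b hab i
    exact ⟨p, hp, hpab, by simp [hpi]⟩
  induction V using Finset.induction_on_max_value y with
  | empty =>
    refine ⟨fun _ => none, by simp [IsSpread], by simp, fun a₁ a₂ b h => ?_⟩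
    simp at h
    omega
  | insert q V hq hmax ih =>
    obtain ⟨c, hc, hcn, hcol⟩ := ih (hx.mono (by simp)) (hy.mono (by simp))
    have hspread : IsSpread x (insert q V) c := by
      intro p hp p' hp' hlt hcc hne
      have hpV : p ∈ V := by
        by_contra h
        exact hne (hcn p h)
      have hp'V : p' ∈ V := by
        by_contra h
        exact hne (hcc ▸ hcn p' h)
      refine (hc p hpV p' hp'V hlt hcc hne).trans (Nat.add_le_add_right (card_le_card ?_) 1)
      exact filter_subset_filter _ (subset_insert _ _)
    obtain ⟨c', hext, hspread', hcol'⟩ := hspread.exists_extension hx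
    refine ⟨fun p => if p ∈ insert q V then c' p else none, ?_, fun p hp => if_neg hp, ?_⟩
    · intro p hp p' hp' hlt hcc hne
      simp only [if_pos hp, if_pos hp'] at hcc hne
      exact hspread' p hp p' hp' hlt hcc hne
    · intro a₁ a₂ b hab i
      rcases lt_or_ge b (y q) with hb | hb
      · rw [filter_insert, if_neg (fun h => absurd h.2.2 (not_le.2 hb))] at hab
        obtain ⟨p, hp, hpab, hpi⟩ := hcol a₁ a₂ b hab i
        refine ⟨p, mem_insert_of_mem hp, hpab, ?_⟩
        simp only [if_pos (mem_insert_of_mem hp)]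
        rw [hext p (by simp [hpi]), hpi]
      · have hyb : ∀ p ∈ insert q V, y p ≤ b := fun p hp => by
          rcases mem_insert.1 hp with rfl | hp
          · exact hb
          · exact (hmax p hp).trans hb
        obtain ⟨p, hp, hpab, hpi⟩ := hcol' a₁ a₂
          (hab.trans (card_le_card (monotone_filter_right _ fun p _ h => ⟨h.1, h.2.1⟩))) i
        exact ⟨p, hp, ⟨hpab.1, hpab.2, hyb p hp⟩, by simpa only [if_pos hp] using hpi⟩

end Bottomless

namespace RangeFamily

/-- The quadrants `{p | u p ≤ a ∧ v p ≤ b}`. -/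
def quadrants (u v : ℝ × ℝ → ℝ) : RangeFamily := {R | ∃ a b : ℝ, R = {p | u p ≤ a ∧ v p ≤ b}}

theorem SW_eq : SW = quadrants (fun p => p.1) (fun p => p.2) := rfl

theorem NW_subset : NW ⊆ quadrants (fun p => p.1) (fun p => -p.2) := by
  rintro R ⟨a, b, rfl⟩
  exact ⟨a, -b, by ext p; simp⟩

theorem SE_subset : SE ⊆ quadrants (fun p => -p.1) (fun p => p.2) := by
  rintro R ⟨a, b, rfl⟩
  exact ⟨-a, b, by ext p; simp⟩

theorem NE_subset : NE ⊆ quadrants (fun p => -p.1) (fun p => -p.2) := by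
  rintro R ⟨a, b, rfl⟩
  exact ⟨-a, -b, by ext p; simp⟩

end RangeFamily

open RangeFamily

theorem exists_hitting_of_subset_quadrants {ℱ 𝒢 : RangeFamily} {u v : ℝ × ℝ → ℝ}
    (hu : ∀ V, InGeneralPosition V → Set.InjOn u V) (hF : ℱ ⊆ quadrants u v)
    (hconv : ∀ R ∈ 𝒢, IsBoxConvex u v R) :
    ∀ V, InGeneralPosition V → ∀ n, 1 ≤ n → ∃ X ⊆ V, ∀ W : Finset (ℝ × ℝ),
      (∀ R ∈ ℱ, (∀ p, p ∈ W ↔ p ∈ V ∧ p ∈ R) → n ≤ #W → (X ∩ W).Nonempty) ∧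
      (∀ R ∈ 𝒢, (∀ p, p ∈ W ↔ p ∈ V ∧ p ∈ R) → #W = n → #(X ∩ W) ≤ 2) := by
  intro V hV n hn
  obtain ⟨X, hXV, hX, hX'⟩ := exists_quadrant_hitting u v V (hu V hV) n hn
  refine ⟨X, hXV, fun W => ⟨fun R hR hW hcard => ?_, fun R hR hW hcard =>
    hX' R (hconv R hR) W hW hcard⟩⟩
  obtain ⟨a, b, rfl⟩ := hF hR
  have : W = V.filter fun p => u p ≤ a ∧ v p ≤ b := by
    ext p
    rw [hW, mem_filter]
    rfl
  obtain ⟨p, hp, h⟩ := hX a b (this ▸ hcard)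
  exact ⟨p, mem_inter.2 ⟨hp, (hW p).2 ⟨hXV hp, h⟩⟩⟩

theorem InGeneralPosition.injOn_neg_fst {V : Finset (ℝ × ℝ)} (hV : InGeneralPosition V) :
    Set.InjOn (fun p : ℝ × ℝ => -p.1) V := fun _ hp _ hq h => hV.1 hp hq (neg_injective h)

theorem isBoxConvex_of_mem_strips_or_quadrants (σ τ : ℝ) (hσ : σ = 1 ∨ σ = -1)
    (hτ : τ = 1 ∨ τ = -1) (R : Set (ℝ × ℝ)) (hR : R ∈ HS ∪ VS ∪ NW ∪ NE ∪ SW ∪ SE) :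
    IsBoxConvex (fun p => σ * p.1) (fun p => τ * p.2) R := by
  intro p hp q hq w h1 h2 h3 h4
  rcases hR with ((((hR | hR) | hR) | hR) | hR) | hR <;> obtain ⟨a, b, rfl⟩ := hR <;>
  simp only [Set.mem_ofPred_eq] at hp hq ⊢ <;>
  rcases hσ with rfl | rfl <;> rcases hτ with rfl | rfl <;>
  constructor <;> linarith [hp.1, hp.2, hq.1, hq.2]

theorem hasShallowHittingSets_four_quadrants :
    HasShallowHittingSets (NW ∪ NE ∪ SW ∪ SE) (HS ∪ VS) 8 := by
  have conv : ∀ σ τ : ℝ, (σ = 1 ∨ σ = -1) → (τ = 1 ∨ τ = -1) →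
      ∀ R ∈ NW ∪ NE ∪ SW ∪ SE ∪ (HS ∪ VS), IsBoxConvex (fun p => σ * p.1) (fun p => τ * p.2) R :=
    fun σ τ hσ hτ R hR => isBoxConvex_of_mem_strips_or_quadrants σ τ hσ hτ R (by
      simp only [Set.mem_union] at hR ⊢; tauto)
  intro V hV n hn
  obtain ⟨X₁, hV1, h1⟩ := exists_hitting_of_subset_quadrants (fun V hV => hV.1) NW_subset
    (by simpa only [one_mul, neg_mul] using conv 1 (-1) (.inl rfl) (.inr rfl)) V hV n hn
  obtain ⟨X₂, hV2, h2⟩ := exists_hitting_of_subset_quadrants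
    (fun V hV => hV.injOn_neg_fst) NE_subset
    (by simpa only [one_mul, neg_mul] using conv (-1) (-1) (.inr rfl) (.inr rfl)) V hV n hn
  obtain ⟨X₃, hV3, h3⟩ := exists_hitting_of_subset_quadrants (fun V hV => hV.1) SW_eq.le
    (by simpa only [one_mul, neg_mul] using conv 1 1 (.inl rfl) (.inl rfl)) V hV n hn
  obtain ⟨X₄, hV4, h4⟩ := exists_hitting_of_subset_quadrants
    (fun V hV => hV.injOn_neg_fst) SE_subset
    (by simpa only [one_mul, neg_mul] using conv (-1) 1 (.inr rfl) (.inl rfl)) V hV n hn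
  refine ⟨X₁ ∪ X₂ ∪ X₃ ∪ X₄, union_subset (union_subset (union_subset hV1 hV2) hV3) hV4,
    fun W => ⟨?_, fun R hR hW hcard => ?_⟩⟩
  · rintro R (((hR | hR) | hR) | hR) hW hcard
    · exact ((h1 W).1 R hR hW hcard).mono (inter_subset_inter_right fun p hp => by simp [hp])
    · exact ((h2 W).1 R hR hW hcard).mono (inter_subset_inter_right fun p hp => by simp [hp])
    · exact ((h3 W).1 R hR hW hcard).mono (inter_subset_inter_right fun p hp => by simp [hp])
    · exact ((h4 W).1 R hR hW hcard).mono (inter_subset_inter_right fun p hp => by simp [hp])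
  · rw [union_inter_distrib_right, union_inter_distrib_right, union_inter_distrib_right]
    have e1 := (h1 W).2 R hR hW hcard
    have e2 := (h2 W).2 R hR hW hcard
    have e3 := (h3 W).2 R hR hW hcard
    have e4 := (h4 W).2 R hR hW hcard
    have := card_union_le (X₁ ∩ W ∪ X₂ ∩ W ∪ X₃ ∩ W) (X₄ ∩ W)
    have := card_union_le (X₁ ∩ W ∪ X₂ ∩ W) (X₃ ∩ W)
    have := card_union_le (X₁ ∩ W) (X₂ ∩ W)
    omega

theorem hasShallowHittingSets_two_quadrants :
    HasShallowHittingSets (NW ∪ SE) (HS ∪ VS ∪ DS) 4 := by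
  have conv : ∀ σ τ : ℝ, ((σ = 1 ∧ τ = -1) ∨ (σ = -1 ∧ τ = 1)) →
      ∀ R ∈ NW ∪ SE ∪ (HS ∪ VS ∪ DS), IsBoxConvex (fun p => σ * p.1) (fun p => τ * p.2) R := by
    intro σ τ hστ R hR
    by_cases hD : R ∈ DS
    · obtain ⟨a, b, rfl⟩ := hD
      intro p hp q hq w h1 h2 h3 h4
      simp only [Set.mem_ofPred_eq] at hp hq ⊢
      rcases hστ with ⟨rfl, rfl⟩ | ⟨rfl, rfl⟩ <;>
      constructor <;> linarith [hp.1, hp.2, hq.1, hq.2]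
    · exact isBoxConvex_of_mem_strips_or_quadrants σ τ (by tauto) (by tauto) R (by
        simp only [Set.mem_union] at hR ⊢; tauto)
  intro V hV n hn
  obtain ⟨X₁, hV1, h1⟩ := exists_hitting_of_subset_quadrants (fun V hV => hV.1) NW_subset
    (by simpa only [one_mul, neg_mul] using conv 1 (-1) (.inl ⟨rfl, rfl⟩)) V hV n hn
  obtain ⟨X₂, hV2, h2⟩ := exists_hitting_of_subset_quadrants
    (fun V hV => hV.injOn_neg_fst) SE_subset
    (by simpa only [one_mul, neg_mul] using conv (-1) 1 (.inr ⟨rfl, rfl⟩)) V hV n hn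
  refine ⟨X₁ ∪ X₂, union_subset hV1 hV2, fun W => ⟨?_, fun R hR hW hcard => ?_⟩⟩
  · rintro R (hR | hR) hW hcard
    · exact ((h1 W).1 R hR hW hcard).mono (inter_subset_inter_right fun p hp => by simp [hp])
    · exact ((h2 W).1 R hR hW hcard).mono (inter_subset_inter_right fun p hp => by simp [hp])
  · rw [union_inter_distrib_right]
    have e1 := (h1 W).2 R hR hW hcard
    have e2 := (h2 W).2 R hR hW hcard
    have := card_union_le (X₁ ∩ W) (X₂ ∩ W)
    omega

theorem hasShallowHittingSets_NW_NE_BL : HasShallowHittingSets (NW ∪ NE) BL 2 := by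
  intro V hV n hn
  obtain ⟨L, hLV, hL, hLb, hLf, hLh, -, -⟩ :=
    exists_leftmost_sweep (fun p : ℝ × ℝ => p.1) (fun p => p.2) n hn V hV.1 hV.2.1
  obtain ⟨R, hRV, hR, hRb, hRf, hRh, -, -⟩ :=
    exists_leftmost_sweep (fun p : ℝ × ℝ => -p.1) (fun p => p.2) n hn V hV.injOn_neg_fst hV.2.1
  refine ⟨L ∪ R, union_subset hLV hRV, fun W => ⟨?_, ?_⟩⟩
  · rintro S (⟨a, b, rfl⟩ | ⟨a, b, rfl⟩) hW hcard
    · have : W = V.filter fun p => p.1 ≤ a ∧ b ≤ p.2 := by ext p; rw [hW, mem_filter]; rfl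
      obtain ⟨p, hp, h⟩ := hL a b (this ▸ hcard)
      exact ⟨p, mem_inter.2 ⟨mem_union_left _ hp, (hW p).2 ⟨hLV hp, h⟩⟩⟩
    · have : W = V.filter fun p => -p.1 ≤ -a ∧ b ≤ p.2 := by
        ext p; rw [hW, mem_filter, neg_le_neg_iff]; rfl
      obtain ⟨p, hp, h⟩ := hR (-a) b (this ▸ hcard)
      exact ⟨p, mem_inter.2 ⟨mem_union_right _ hp, (hW p).2 ⟨hRV hp, neg_le_neg_iff.1 h.1, h.2⟩⟩⟩
  · rintro S ((⟨a, b, rfl⟩ | ⟨a, b, rfl⟩) | ⟨a₁, a₂, b, rfl⟩) hW hcard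
    · exact card_inter_quadrant_le_two (fun p => p.1) (fun p => p.2) n V L R W hV.1 hLV hRV hLf hLh
        (fun r hr s hs h => hRh r hr s hs (neg_lt_neg h)) a b (fun p => by rw [hW]; rfl) hcard
    · rw [union_comm]
      exact card_inter_quadrant_le_two (fun p => -p.1) (fun p => p.2) n V R L W hV.injOn_neg_fst
        hRV hLV hRf hRh (fun r hr s hs h => hLh r hr s hs (neg_lt_neg_iff.1 h)) (-a) b
        (fun p => by rw [hW, neg_le_neg_iff]; rfl) hcard
    · have atMostOne : ∀ (x : ℝ × ℝ → ℝ) (Y : Finset (ℝ × ℝ)), Y ⊆ V → Set.InjOn x V →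
          (∀ l ∈ Y ∩ W, ∀ l' ∈ Y ∩ W, ¬ x l < x l') → #(Y ∩ W) ≤ 1 := by
        intro x Y hY hx h
        rw [card_le_one]
        intro l hl l' hl'
        exact hx (hY (mem_inter.1 hl).1) (hY (mem_inter.1 hl').1)
          (le_antisymm (not_lt.1 (h _ hl' _ hl)) (not_lt.1 (h _ hl _ hl')))
      have e1 : #(L ∩ W) ≤ 1 := by
        refine atMostOne _ L hLV hV.1 fun l hl l' hl' hlt => ?_
        rw [mem_inter] at hl hl'
        have h1 := ((hW l).1 hl.2).2
        have h2 := ((hW l').1 hl'.2).2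
        refine absurd (hLb l hl.1 l' hl'.1 hlt) (not_lt.2 (hcard ▸ card_le_card fun q hq => ?_))
        rw [mem_filter] at hq
        exact (hW q).2 ⟨hq.1, h1.1.trans hq.2.1, hq.2.2.1.trans h2.2.1, hq.2.2.2.trans h2.2.2⟩
      have e2 : #(R ∩ W) ≤ 1 := by
        refine atMostOne _ R hRV hV.injOn_neg_fst fun l hl l' hl' hlt => ?_
        rw [mem_inter] at hl hl'
        have h1 := ((hW l).1 hl.2).2
        have h2 := ((hW l').1 hl'.2).2
        refine absurd (hRb l hl.1 l' hl'.1 hlt) (not_lt.2 (hcard ▸ card_le_card fun q hq => ?_))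
        rw [mem_filter] at hq
        exact (hW q).2 ⟨hq.1, h2.1.trans (neg_le_neg_iff.1 hq.2.2.1),
          (neg_le_neg_iff.1 hq.2.1).trans h1.2.1, hq.2.2.2.trans h2.2.2⟩
      rw [union_inter_distrib_right]
      exact (card_union_le _ _).trans (by omega)

theorem exists_showsAllColors_BL {k : ℕ} (hk : 1 ≤ k) (V : Finset (ℝ × ℝ))
    (hV : InGeneralPosition V) : ∃ c : ℝ × ℝ → Fin k, ShowsAllColors V BL (3 * k - 2) c := by
  obtain ⟨c, hc⟩ := exists_coloring_bottomless hV.1 hV.2.1 hk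
  refine ⟨c, ?_⟩
  rintro R ⟨a₁, a₂, b, rfl⟩ W hW hcard i
  have : W = V.filter fun p => a₁ ≤ p.1 ∧ p.1 ≤ a₂ ∧ p.2 ≤ b := by
    ext p; rw [hW, mem_filter]; rfl
  obtain ⟨p, hp, h, hi⟩ := hc a₁ a₂ b (this ▸ hcard) i
  exact ⟨p, (hW p).2 ⟨hp, h⟩, hi⟩

theorem exists_showsAllColors_HS_VS {k : ℕ} (hk : 1 ≤ k) (V : Finset (ℝ × ℝ))
    (hV : InGeneralPosition V) :
    ∃ c : ℝ × ℝ → Fin k, ShowsAllColors V (HS ∪ VS) (2 * k - 1) c := by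
  obtain ⟨c, hc⟩ := exists_coloring_two_strips hV.2.1 hV.1 hk
  refine ⟨c, ?_⟩
  rintro R (⟨a, b, rfl⟩ | ⟨a, b, rfl⟩) W hW hcard i
  · have : W = V.filter fun p => a ≤ p.2 ∧ p.2 ≤ b := by ext p; rw [hW, mem_filter]; rfl
    obtain ⟨p, hp, h, hi⟩ := (hc a b i).1 (this ▸ hcard)
    exact ⟨p, (hW p).2 ⟨hp, h⟩, hi⟩
  · have : W = V.filter fun p => a ≤ p.1 ∧ p.1 ≤ b := by ext p; rw [hW, mem_filter]; rfl
    obtain ⟨p, hp, h, hi⟩ := (hc a b i).2 (this ▸ hcard)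
    exact ⟨p, (hW p).2 ⟨hp, h⟩, hi⟩

theorem exists_showsAllColors_HS_VS_DS {k : ℕ} (hk : 2 ≤ k) (V : Finset (ℝ × ℝ))
    (hV : InGeneralPosition V) :
    ∃ c : ℝ × ℝ → Fin k, ShowsAllColors V (HS ∪ VS ∪ DS) (8 * k - 9) c := by
  obtain ⟨c, hc⟩ := exists_coloring_three_strips hV.2.1 hV.1 hV.2.2 hk
  refine ⟨c, ?_⟩
  rintro R ((⟨a, b, rfl⟩ | ⟨a, b, rfl⟩) | ⟨a, b, rfl⟩) W hW hcard i
  · have : W = V.filter fun p => a ≤ p.2 ∧ p.2 ≤ b := by ext p; rw [hW, mem_filter]; rfl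
    obtain ⟨p, hp, h, hi⟩ := (hc a b i).1 (by rw [← this]; omega)
    exact ⟨p, (hW p).2 ⟨hp, h⟩, hi⟩
  · have : W = V.filter fun p => a ≤ p.1 ∧ p.1 ≤ b := by ext p; rw [hW, mem_filter]; rfl
    obtain ⟨p, hp, h, hi⟩ := (hc a b i).2.1 (by rw [← this]; omega)
    exact ⟨p, (hW p).2 ⟨hp, h⟩, hi⟩
  · have : W = V.filter fun p => a ≤ p.1 + p.2 ∧ p.1 + p.2 ≤ b := by
      ext p; rw [hW, mem_filter]; rfl
    obtain ⟨p, hp, h, hi⟩ := (hc a b i).2.2 (this ▸ hcard)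
    exact ⟨p, (hW p).2 ⟨hp, h⟩, hi⟩

theorem eight_mul_sub_nine_le_ceil {k : ℕ} (hk : 2 ≤ k) :
    8 * k - 9 ≤ ⌈4 * (k : ℝ) * Real.log (k : ℝ) + (k : ℝ) * Real.log 3⌉₊ := by
  have hk' : (2 : ℝ) ≤ k := by exact_mod_cast hk
  have hk0 : (0 : ℝ) < k := by linarith
  have h3 : (1 : ℝ) ≤ Real.log 3 := by
    rw [Real.le_log_iff_exp_le (by norm_num)]
    linarith [Real.exp_one_lt_d9]
  -- the tangent line of the logarithm at `c`
  have tangent : ∀ c : ℝ, 0 < c → k * (Real.log c + 1) - c ≤ k * Real.log k := by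
    intro c hc
    have h := Real.one_sub_inv_le_log_of_pos (div_pos hk0 hc)
    rw [Real.log_div hk0.ne' hc.ne', inv_div] at h
    have := mul_le_mul_of_nonneg_left h hk0.le
    rw [mul_sub, mul_div_cancel₀ _ hk0.ne'] at this
    linarith
  have main : (8 : ℝ) * k - 9 ≤ 4 * k * Real.log k + k * Real.log 3 := by
    have h2 := Real.log_two_gt_d9
    have hk3 : (k : ℝ) ≤ k * Real.log 3 := le_mul_of_one_le_right hk0.le h3
    have hk2 : (k : ℝ) * 0.6931 ≤ k * Real.log 2 :=
      mul_le_mul_of_nonneg_left (by linarith) hk0.le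
    rcases le_or_gt k 4 with h | h
    · have h4 : (k : ℝ) ≤ 4 := by exact_mod_cast h
      linarith [tangent 2 two_pos]
    · have h4 : (4 : ℝ) < k := by exact_mod_cast h
      have ht := tangent (2 ^ 2) (by norm_num)
      rw [Real.log_pow] at ht
      push_cast at ht
      linarith
  have : ((8 * k - 9 : ℕ) : ℝ) ≤ 4 * k * Real.log k + k * Real.log 3 := by
    rw [Nat.cast_sub (by omega)]
    push_cast
    exact main
  exact_mod_cast this.trans (Nat.le_ceil _)

theorem mainTheorem3 (k : ℕ) (hk : 1 ≤ k) :
    polychromaticNumber (RangeFamily.BL ∪ RangeFamily.NW ∪ RangeFamily.NE) k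
      ≤ ((5 * k - 2 : ℕ) : ℕ∞) ∧
    polychromaticNumber
        (RangeFamily.HS ∪ RangeFamily.VS ∪ RangeFamily.NW ∪ RangeFamily.NE ∪
          RangeFamily.SW ∪ RangeFamily.SE) k
      ≤ ((10 * k - 1 : ℕ) : ℕ∞) ∧
    polychromaticNumber
        (RangeFamily.HS ∪ RangeFamily.VS ∪ RangeFamily.DS ∪ RangeFamily.NW ∪
          RangeFamily.SE) k
      ≤ ((⌈4 * (k : ℝ) * Real.log (k : ℝ) + (k : ℝ) * Real.log 3⌉₊ + 4 * k : ℕ) : ℕ∞) := by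
  refine ⟨?_, ?_, ?_⟩
  · rw [show BL ∪ NW ∪ NE = NW ∪ NE ∪ BL by rw [Set.union_assoc, Set.union_comm]]
    exact polychromaticNumber_le (by omega) (by omega)
      (exists_showsAllColors_of_hasShallowHittingSets (M := 3 * k - 2) (by omega)
        (isShrinkable_NW.union isShrinkable_NE) isShrinkable_BL hasShallowHittingSets_NW_NE_BL
        (exists_showsAllColors_BL hk))
  · rw [show HS ∪ VS ∪ NW ∪ NE ∪ SW ∪ SE = NW ∪ NE ∪ SW ∪ SE ∪ (HS ∪ VS) by
      rw [Set.union_comm (NW ∪ NE ∪ SW ∪ SE)]; simp only [Set.union_assoc]]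
    exact polychromaticNumber_le (by omega) (by omega)
      (exists_showsAllColors_of_hasShallowHittingSets (M := 2 * k - 1) (by omega)
        (((isShrinkable_NW.union isShrinkable_NE).union isShrinkable_SW).union isShrinkable_SE)
        (isShrinkable_HS.union isShrinkable_VS) hasShallowHittingSets_four_quadrants
        (exists_showsAllColors_HS_VS hk))
  · rcases hk.eq_or_lt with rfl | hk
    · refine polychromaticNumber_le (m := 1) one_pos (by omega) fun V _ => ⟨fun _ => 0, ?_⟩
      intro R _ W _ hcard i
      obtain ⟨p, hp⟩ := card_pos.1 hcard
      exact ⟨p, hp, Subsingleton.elim _ _⟩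
    · rw [show HS ∪ VS ∪ DS ∪ NW ∪ SE = NW ∪ SE ∪ (HS ∪ VS ∪ DS) by
        rw [Set.union_comm (NW ∪ SE)]; simp only [Set.union_assoc]]
      exact polychromaticNumber_le (by omega)
        (Nat.add_le_add_right (eight_mul_sub_nine_le_ceil hk) _)
        (exists_showsAllColors_of_hasShallowHittingSets (M := 8 * k - 9) (by omega)
          (isShrinkable_NW.union isShrinkable_SE)
          ((isShrinkable_HS.union isShrinkable_VS).union isShrinkable_DS)
          hasShallowHittingSets_two_quadrants (exists_showsAllColors_HS_VS_DS hk))
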